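/- Let $\Gamma$ be a countable group. For an action $a$ of $\Gamma$ by measurable, measure preserving maps on a probability space $(X,\mu)$ and such an action $b$ on $(Y,\nu)$, say that $a$ is weakly contained in $b$, written $a\prec b$, if for every finite partition $A_0,\dots,A_{k-1}$ of $X$ into measurable sets (possibly empty), every finite $F\subseteq\Gamma$ and every $\varepsilon>0$ there is a partition $B_0,\dots,B_{k-1}$ of $Y$ into measurable sets (possibly empty) such that $$|\mu(\gamma^a A_i\cap A_j)-\nu(\gamma^b B_i\cap B_j)|<\varepsilon\qquad\text{for all }\gamma\in F,\ 0\le i,j<k.$$ Call $b$ universal if $a\prec b$ for every measure preserving action $a$ of $\Gamma$ on a standard probability space. Let $p_\Gamma$ be the action of $\Gamma$ by left translation on its profinite completion (the inverse limit of all finite quotients of $\Gamma$) with its Borel $\sigma$-algebra and normalized Haar measure, and let $\iota$ be the identity action of $\Gamma$ on a standard non-atomic probability space, for instance $[0,1]$ with Lebesgue measure. A countably infinite group $\Gamma$ has property EMD if $p_\Gamma$ is universal, and property MD if the product action $\iota\times p_\Gamma$ is universal. Theorem 4.7. Suppose $\Gamma_1$ and $\Gamma_2$ are nontrivial countable groups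 and that for each $i\in\{1,2\}$, $\Gamma_i$ is either finite or has property MD. Then the free product $\Gamma_1*\Gamma_2$ has property EMD. -/

import Mathlib

open MeasureTheory Set

/-- A measurable action of the (countable, discrete) group `Γ` on `X` that preserves the measure `μ`:
a homomorphism from `Γ` to the permutations of `X` all of whose values are measurable and preserve
`μ`.  (For a countable discrete `Γ` this is the same as measurability of `Γ × X → X`.) -/
structure MPAction (Γ : Type*) [Group Γ] {X : Type*} [MeasurableSpace X] (μ : Measure X) where
  /-- the action -/
  toHom : Γ →* Equiv.Perm X
  /-- each group element acts by a measurable, measure preserving map -/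
  measurePreserving : ∀ γ : Γ, MeasurePreserving (toHom γ) μ μ

namespace MPAction

variable {Γ : Type*} [Group Γ] {X Y : Type*} [MeasurableSpace X] [MeasurableSpace Y]
  {μ : Measure X} {ν : Measure Y}

/-- The trivial (identity) action of `Γ` on `(X, μ)`. -/
def trivialAction (Γ : Type*) [Group Γ] {X : Type*} [MeasurableSpace X] (μ : Measure X) :
    MPAction Γ μ where
  toHom := 1
  measurePreserving _ := MeasurePreserving.id μ

/-- The diagonal action of `Γ` on the product space. -/
def prod [SFinite μ] [SFinite ν] (a : MPAction Γ μ) (b : MPAction Γ ν) :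
    MPAction Γ (μ.prod ν) where
  toHom :=
    { toFun := fun γ => Equiv.prodCongr (a.toHom γ) (b.toHom γ)
      map_one' := by ext x <;> simp
      map_mul' := fun γ δ => by ext x <;> simp }
  measurePreserving γ := (a.measurePreserving γ).prod (b.measurePreserving γ)

/-- Weak containment `a ≺ b`.  A partition into `k` measurable pieces is a pairwise disjoint family
of measurable sets indexed by `Fin k` that covers the space (pieces may be empty). -/
def WeaklyContained (a : MPAction Γ μ) (b : MPAction Γ ν) : Prop :=
  ∀ (k : ℕ) (A : Fin k → Set X), (∀ i, MeasurableSet (A i)) →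
    Pairwise (fun i j => Disjoint (A i) (A j)) → ⋃ i, A i = univ →
    ∀ (F : Finset Γ) (ε : ℝ), 0 < ε →
      ∃ B : Fin k → Set Y, (∀ i, MeasurableSet (B i)) ∧
        Pairwise (fun i j => Disjoint (B i) (B j)) ∧ ⋃ i, B i = univ ∧
        ∀ γ ∈ F, ∀ i j : Fin k,
          |μ.real (a.toHom γ '' A i ∩ A j) - ν.real (b.toHom γ '' B i ∩ B j)| < ε

/-- `b` is universal: it weakly contains every measure preserving action of `Γ` on a standard
probability space.  (Every standard Borel space is Borel isomorphic to one in `Type`, so that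
it is enough to let `X` range over `Type`.) -/
def IsUniversal (b : MPAction Γ ν) : Prop :=
  ∀ (X : Type) [MeasurableSpace X] [StandardBorelSpace X] (μ : Measure X) [IsProbabilityMeasure μ]
    (a : MPAction Γ μ), a.WeaklyContained b

end MPAction

/-- The profinite completion of the group `Γ`: the inverse limit of its finite quotients. -/
def ProfiniteHat (Γ : Type*) [Group Γ] : Type _ :=
  ProfiniteGrp.ProfiniteCompletion.completion (GrpCat.of Γ)

namespace ProfiniteHat

variable (Γ : Type*) [Group Γ]

instance : Group (ProfiniteHat Γ) :=
  inferInstanceAs (Group (ProfiniteGrp.ProfiniteCompletion.completion (GrpCat.of Γ)))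

instance : TopologicalSpace (ProfiniteHat Γ) :=
  inferInstanceAs (TopologicalSpace (ProfiniteGrp.ProfiniteCompletion.completion (GrpCat.of Γ)))

instance : IsTopologicalGroup (ProfiniteHat Γ) :=
  inferInstanceAs (IsTopologicalGroup (ProfiniteGrp.ProfiniteCompletion.completion (GrpCat.of Γ)))

instance : CompactSpace (ProfiniteHat Γ) :=
  inferInstanceAs (CompactSpace (ProfiniteGrp.ProfiniteCompletion.completion (GrpCat.of Γ)))

instance : MeasurableSpace (ProfiniteHat Γ) := borel _

instance : BorelSpace (ProfiniteHat Γ) := ⟨rfl⟩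

/-- The canonical homomorphism from `Γ` to its profinite completion. -/
def ofGroup : Γ →* ProfiniteHat Γ :=
  (ProfiniteGrp.ProfiniteCompletion.eta (GrpCat.of Γ)).hom

/-- The normalized Haar measure of the profinite completion. -/
noncomputable def haar : Measure (ProfiniteHat Γ) :=
  Measure.haarMeasure ⊤

instance : IsProbabilityMeasure (haar Γ) :=
  ⟨by simpa [haar] using Measure.haarMeasure_self (K₀ := (⊤ : TopologicalSpace.PositiveCompacts (ProfiniteHat Γ)))⟩

instance : (haar Γ).IsMulLeftInvariant :=
  inferInstanceAs (Measure.haarMeasure _).IsMulLeftInvariant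

/-- The action of `Γ` on its profinite completion by left translation, with the normalized
Haar measure. -/
noncomputable def action : MPAction Γ (haar Γ) where
  toHom := (MulAction.toPermHom (ProfiniteHat Γ) (ProfiniteHat Γ)).comp (ofGroup Γ)
  measurePreserving γ := measurePreserving_mul_left (haar Γ) (ofGroup Γ γ)

end ProfiniteHat

/-- Property EMD of a countably infinite group: the action on the profinite completion is
universal. -/
def HasEMD (Γ : Type*) [Group Γ] : Prop :=
  Countable Γ ∧ Infinite Γ ∧ (ProfiniteHat.action Γ).IsUniversal

/-- Property MD of a countably infinite group: the product of the identity action on a standard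
non-atomic probability space (the unit interval with Lebesgue measure, which up to
isomorphism is the only one) with the action on the profinite completion is universal. -/
def HasMD (Γ : Type*) [Group Γ] : Prop :=
  Countable Γ ∧ Infinite Γ ∧
    ((MPAction.trivialAction Γ (volume : Measure unitInterval)).prod
      (ProfiniteHat.action Γ)).IsUniversal

/-! The argument works with statistics: for a finite colouring `c`, how often `c x = i` and `c (γ x)
= j`. A group is `FinitelyApproximable` if all such statistics are approximated by finite actions
with uniform measure. Finite groups have this property because a colouring factors through the
finite shift on `Γ → K`, whose invariant vector is rounded to a uniform one. MD groups have it
because a colouring of `[0,1]` times the profinite completion is nearly invariant under an open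
subgroup, hence nearly factors through a finite action. If the finite actions can moreover be
transitive, each is a factor of the profinite completion, and EMD follows.

For the free product, any two actions of the factors on one set combine freely. Given an action and
a colouring, record the colours seen along a finite window of group elements, model this richer
colouring separately for each factor on sets of equal size, and glue by a bijection matching most
colours. Equivariance of the labels then fails rarely for each letter, hence rarely for each word in
question.

Transitivity costs nothing in the limit. If neither factor fixes a point, colour-preserving swaps
leave at most one component per colour, and boundedly many further swaps connect these; in a large
set they are negligible (`Setoid.exists_perm_sup_comap_eq_top`). Nontriviality supplies the fixed
point free actions, through the Bernoulli shift. -/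

/-- The proportion of the elements of a finite type that satisfy `p`. -/
noncomputable def freq {V : Type*} (p : V → Prop) : ℝ :=
  ({v | p v}.ncard : ℝ) / Nat.card V

/-! ### Frequencies in finite sets -/

section freq

variable {V W L : Type*}

theorem freq_mono [Finite V] {p q : V → Prop} (h : ∀ v, p v → q v) : freq p ≤ freq q := by
  unfold freq
  gcongr
  · exact toFinite _
  · exact h _

theorem freq_or_le [Finite V] (p q : V → Prop) :
    freq (fun v => p v ∨ q v) ≤ freq p + freq q := by
  unfold freq
  rw [← add_div]
  gcongr
  exact_mod_cast ncard_union_le {v | p v} {v | q v}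

theorem freq_comp_equiv (e : V ≃ W) (p : W → Prop) : freq (fun v => p (e v)) = freq p := by
  unfold freq
  rw [Nat.card_congr e, ← ncard_preimage_of_injective_subset_range e.injective (s := {w | p w})
    (by simp)]
  rfl

theorem freq_comp_fst [Finite W] [Nonempty W] (p : V → Prop) :
    freq (fun x : V × W => p x.1) = freq p := by
  unfold freq
  have h : {x : V × W | p x.1} = {v | p v} ×ˢ (univ : Set W) := by ext; simp
  rw [h, ncard_prod, Nat.card_prod, ncard_univ]
  have : (Nat.card W : ℝ) ≠ 0 := by exact_mod_cast Nat.card_pos.ne'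
  push_cast
  field_simp

theorem freq_comp_eq_sum [Finite V] [Fintype L] (d : V → L) (Q : L → Prop) [DecidablePred Q] :
    freq (fun v => Q (d v)) = ∑ l with Q l, freq (fun v => d v = l) := by
  classical
  have := Fintype.ofFinite V
  unfold freq
  rw [← Finset.sum_div, ← Nat.cast_sum]
  congr 2
  simp only [ncard_eq_toFinset_card', toFinset_ofPred]
  rw [Finset.card_eq_sum_card_fiberwise (f := d) (t := Finset.univ.filter Q)
    (fun v hv => by simpa using hv)]
  refine Finset.sum_congr rfl fun l hl => ?_
  rw [Finset.filter_filter]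
  congr 1
  ext v
  simp only [Finset.mem_filter, Finset.mem_univ, true_and] at hl ⊢
  exact ⟨fun h => h.2, fun h => ⟨h ▸ hl, h⟩⟩

theorem freq_le_add [Finite V] {p q r : V → Prop} (h : ∀ v, p v → q v ∨ r v) :
    freq p ≤ freq q + freq r :=
  (freq_mono h).trans (freq_or_le q r)

theorem abs_freq_sub_freq_le [Finite V] {p q r : V → Prop} (h : ∀ v, ¬ r v → (p v ↔ q v)) :
    |freq p - freq q| ≤ freq r := by
  rw [abs_sub_le_iff]
  constructor
  · have := freq_le_add (p := p) (q := q) (r := r) fun v hv => by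
      by_cases hr : r v
      · exact .inr hr
      · exact .inl ((h v hr).1 hv)
    linarith
  · have := freq_le_add (p := q) (q := p) (r := r) fun v hv => by
      by_cases hr : r v
      · exact .inr hr
      · exact .inl ((h v hr).2 hv)
    linarith

theorem measureReal_comp_eq_sum {X : Type*} [MeasurableSpace X] (μ : Measure X) [IsFiniteMeasure μ]
    [Fintype L] (e : X → L) (he : ∀ l, MeasurableSet (e ⁻¹' {l})) (Q : L → Prop)
    [DecidablePred Q] :
    μ.real {x | Q (e x)} = ∑ l with Q l, μ.real {x | e x = l} := by
  have := sum_measureReal_preimage_singleton (μ := μ) (Finset.univ.filter Q) (f := e)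
    (fun l _ => he l)
  simp only [preimage, mem_singleton_iff, Finset.coe_filter, Finset.mem_univ, true_and,
    mem_ofPred_eq] at this
  exact this.symm

end freq

/-! ### Approximation by finite actions -/

namespace MPAction

/-- Restriction of an action along a group homomorphism. -/
def comap {Γ Δ : Type*} [Group Γ] [Group Δ] {X : Type*} [MeasurableSpace X] {μ : Measure X}
    (a : MPAction Γ μ) (f : Δ →* Γ) : MPAction Δ μ where
  toHom := a.toHom.comp f
  measurePreserving δ := a.measurePreserving (f δ)

/-- The joint statistics of the colouring `d` under the finite action `σ` are, for the group
elements in `F`, within `ε` of those of the colouring `c` under the action `a`. -/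
def Approximates {Γ : Type*} [Group Γ] {X : Type*} [MeasurableSpace X] {μ : Measure X}
    (a : MPAction Γ μ) {K V : Type*} (c : X → K) (F : Finset Γ) (ε : ℝ)
    (σ : Γ →* Equiv.Perm V) (d : V → K) : Prop :=
  ∀ γ ∈ F, ∀ i j, |μ.real {x | c x = i ∧ c (a.toHom γ x) = j} -
    freq (fun v => d v = i ∧ d (σ γ v) = j)| < ε

end MPAction

/-- The joint statistics of finite measurable colourings under measure preserving actions of `Γ` on
standard probability spaces are approximated by those of finite actions. -/
def FinitelyApproximable (Γ : Type*) [Group Γ] : Prop :=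
  ∀ (X : Type) [MeasurableSpace X] [StandardBorelSpace X] (μ : Measure X) [IsProbabilityMeasure μ]
    (a : MPAction Γ μ) (K : Type) [Finite K] (c : X → K), (∀ i, MeasurableSet (c ⁻¹' {i})) →
    ∀ (F : Finset Γ) (ε : ℝ), 0 < ε →
      ∃ (V : Type) (_ : Finite V) (_ : Nonempty V) (σ : Γ →* Equiv.Perm V) (d : V → K),
        a.Approximates c F ε σ d

/-- The same with transitive finite actions on arbitrarily large sets. -/
def TransitivelyApproximable (Γ : Type*) [Group Γ] : Prop :=
  ∀ (X : Type) [MeasurableSpace X] [StandardBorelSpace X] (μ : Measure X) [IsProbabilityMeasure μ]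
    (a : MPAction Γ μ) (K : Type) [Finite K] (c : X → K), (∀ i, MeasurableSet (c ⁻¹' {i})) →
    ∀ (F : Finset Γ) (ε : ℝ), 0 < ε → ∀ n : ℕ,
      ∃ (V : Type) (_ : Finite V) (_ : Nonempty V) (σ : Γ →* Equiv.Perm V) (d : V → K),
        n ≤ Nat.card V ∧ (∀ v w, ∃ γ, σ γ v = w) ∧ a.Approximates c F ε σ d

open Classical in
/-- A finite action with an invariant probability vector is approximated, together with this
vector, by finite actions with the uniform one. -/
theorem exists_uniform_model {Γ : Type*} [Group Γ] {W : Type} [Fintype W]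
    (ρ : Γ →* Equiv.Perm W) (m : W → ℝ) (hm : ∀ w, 0 ≤ m w) (hm1 : ∑ w, m w = 1)
    (hinv : ∀ γ w, m (ρ γ w) = m w) {ε : ℝ} (hε : 0 < ε) :
    ∃ (V : Type) (_ : Finite V) (_ : Nonempty V) (σ : Γ →* Equiv.Perm V) (π : V → W),
      (∀ γ v, π (σ γ v) = ρ γ (π v)) ∧
      ∀ Q : W → Prop, |∑ w with Q w, m w - freq (fun v => Q (π v))| < ε := by
  obtain ⟨M, hM⟩ := exists_nat_gt (2 * Fintype.card W / ε)
  have hW : 0 < Fintype.card W := by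
    rw [Fintype.card_pos_iff]
    by_contra h
    rw [not_nonempty_iff] at h
    simp at hm1
  have hM0 : (0 : ℝ) < M := lt_of_le_of_lt (by positivity) hM
  -- `n w` is the size of the fibre over `w`. It depends only on `m w`, so it is `ρ`-invariant; the
  -- `+ 1` makes the total size at least `M`.
  set n : W → ℕ := fun w => ⌊M * m w⌋₊ + 1 with hn
  have hninv : ∀ γ w, n (ρ γ w) = n w := fun γ w => by simp [hn, hinv]
  have hn1 : ∀ w, M * m w ≤ n w := fun w => by
    have := Nat.lt_floor_add_one (M * m w); push_cast [hn]; linarith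
  have hn2 : ∀ w, (n w : ℝ) ≤ M * m w + 1 := fun w => by
    have := Nat.floor_le (mul_nonneg hM0.le (hm w)); push_cast [hn]; linarith
  have hnb : ∀ w, n w ≤ M + 1 := fun w => by
    have h1 : m w ≤ 1 := hm1 ▸ Finset.single_le_sum (fun w _ => hm w) (Finset.mem_univ w)
    have : (n w : ℝ) ≤ M + 1 := (hn2 w).trans (by nlinarith)
    exact_mod_cast this
  let V := {p : W × Fin (M + 1) // (p.2 : ℕ) < n p.1}
  let τ : Γ →* Equiv.Perm (W × Fin (M + 1)) :=
    { toFun := fun γ => Equiv.prodCongr (ρ γ) (Equiv.refl _)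
      map_one' := by ext x <;> simp
      map_mul' := fun γ δ => by ext x <;> simp }
  have hτ : ∀ γ (p : W × Fin (M + 1)), ((τ γ p).2 : ℕ) < n (τ γ p).1 ↔ (p.2 : ℕ) < n p.1 :=
    fun γ p => by
      change (p.2 : ℕ) < n (ρ γ p.1) ↔ _
      rw [hninv]
  let σ : Γ →* Equiv.Perm V :=
    { toFun := fun γ => (τ γ).subtypePerm (hτ γ)
      map_one' := by ext x : 2; simp [Equiv.Perm.subtypePerm_apply]
      map_mul' := fun γ δ => by ext x : 2; simp [Equiv.Perm.subtypePerm_apply] }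
  have hfib : ∀ w, {v : V | v.1.1 = w}.ncard = n w := by
    intro w
    rw [← Nat.card_fin (n w), ← Nat.card_coe_set_eq]
    refine Nat.card_congr ⟨fun v => ⟨v.1.1.2, by have := v.1.2; rwa [v.2] at this⟩,
      fun t => ⟨⟨(w, ⟨t, t.2.trans_le (hnb w)⟩), t.2⟩, rfl⟩, ?_, ?_⟩
    · rintro ⟨⟨⟨w', t⟩, h⟩, h'⟩
      obtain rfl : w' = w := h'
      rfl
    · intro t; rfl
  have hcard : Nat.card V = ∑ w, n w := by
    have := Fintype.ofFinite V
    rw [Nat.card_eq_fintype_card, ← Finset.card_univ,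
      Finset.card_eq_sum_card_fiberwise (f := fun v : V => v.1.1) (t := Finset.univ)
      (fun _ _ => by simp)]
    refine Finset.sum_congr rfl fun w _ => ?_
    rw [← hfib w, ncard_eq_toFinset_card']
    congr 1
    ext; simp
  set T : ℝ := ((Nat.card V : ℕ) : ℝ) with hT
  have hTM : (M : ℝ) ≤ T := by
    calc (M : ℝ) = ∑ w, M * m w := by rw [← Finset.mul_sum, hm1, mul_one]
      _ ≤ ∑ w, (n w : ℝ) := Finset.sum_le_sum fun w _ => hn1 w
      _ = T := by rw [hT, hcard]; push_cast; rfl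
  have hTM2 : T ≤ M + Fintype.card W := by
    calc T = ∑ w, (n w : ℝ) := by rw [hT, hcard]; push_cast; rfl
      _ ≤ ∑ w, (M * m w + 1) := Finset.sum_le_sum fun w _ => hn2 w
      _ = M + Fintype.card W := by
        rw [Finset.sum_add_distrib, ← Finset.mul_sum, hm1]; simp
  have hT0 : 0 < T := hM0.trans_le hTM
  have hne : Nonempty V := by
    have : 0 < Nat.card V := Nat.cast_pos.1 hT0
    exact (Nat.card_pos_iff.1 this).1
  refine ⟨V, inferInstance, hne, σ, fun v => v.1.1, fun γ v => rfl, fun Q => ?_⟩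
  rw [freq_comp_eq_sum, ← Finset.sum_sub_distrib]
  -- After multiplying by `T`, this combines `M ≤ T ≤ M + |W|` with `M * m w ≤ n w ≤ M * m w + 1`.
  have hterm : ∀ w, |m w - freq (fun v : V => v.1.1 = w)| ≤ (m w * Fintype.card W + 1) / T := by
    intro w
    have : freq (fun v : V => v.1.1 = w) = n w / T := by rw [freq, hfib]
    rw [this, le_div_iff₀ hT0, ← abs_of_pos hT0, ← abs_mul, sub_mul, abs_of_pos hT0,
      div_mul_cancel₀ _ hT0.ne', abs_sub_le_iff]
    have := hn1 w
    have := hn2 w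
    have := hm w
    constructor <;> nlinarith
  calc _ ≤ ∑ w with Q w, |m w - freq (fun v : V => v.1.1 = w)| := Finset.abs_sum_le_sum_abs _ _
    _ ≤ ∑ w, |m w - freq (fun v : V => v.1.1 = w)| :=
      Finset.sum_le_sum_of_subset_of_nonneg (Finset.subset_univ _) fun _ _ _ => abs_nonneg _
    _ ≤ ∑ w, (m w * Fintype.card W + 1) / T := Finset.sum_le_sum fun w _ => hterm w
    _ = 2 * Fintype.card W / T := by
      rw [← Finset.sum_div, Finset.sum_add_distrib, ← Finset.sum_mul, hm1]
      simp; ring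
    _ ≤ 2 * Fintype.card W / M := by gcongr
    _ < ε := by rw [div_lt_iff₀ hM0]; rw [div_lt_iff₀ hε] at hM; linarith

/-! ### Joining components by swaps -/

section transitivity

variable {V L : Type*}

theorem Setoid.card_quotient_lt [Finite V] {r s : Setoid V} (h : r < s) :
    Nat.card (Quotient s) < Nat.card (Quotient r) := by
  let f : Quotient r → Quotient s := Quotient.map id fun a b hab => h.le hab
  have hf : Function.Surjective f := fun q => q.inductionOn fun v => ⟨Quotient.mk r v, rfl⟩
  refine lt_of_le_of_ne (Nat.card_le_card_of_surjective f hf) fun heq => h.not_ge ?_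
  have hinj : Function.Injective f :=
    ((Nat.bijective_iff_surjective_and_card f).2 ⟨hf, heq.symm⟩).1
  exact fun a b hab => Quotient.exact
    (hinj (show f (Quotient.mk r a) = f (Quotient.mk r b) from Quotient.sound hab))

theorem Setoid.sup_left {r s : Setoid V} {u v : V} (h : r u v) : (r ⊔ s) u v :=
  (le_sup_left : r ≤ r ⊔ s) h

theorem Setoid.sup_right {r s : Setoid V} {u v : V} (h : s u v) : (r ⊔ s) u v :=
  (le_sup_right : s ≤ r ⊔ s) h

open Classical in
/-- A class of `r ⊔ s` contains a point `x` whose removal leaves it connected; exchanging the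
`s`-classes of `x` and of any point `y` outside the class merges two classes of `r ⊔ s`. -/
theorem Setoid.exists_lt_sup_comap_swap [Finite V] (r s : Setoid V)
    (hr : ∀ v, ∃ w, w ≠ v ∧ r v w) (hs : ∀ v, ∃ w, w ≠ v ∧ s v w) (c : V) :
    ∃ x, (r ⊔ s) c x ∧ ∀ y, ¬ (r ⊔ s) c y → r ⊔ s < r ⊔ s.comap (Equiv.swap x y) := by
  let C := {v // (r ⊔ s) c v}
  let G : SimpleGraph C := SimpleGraph.fromRel fun u v => r u v ∨ s u v
  have hreach : ∀ u v, (r ⊔ s) u v → ∀ hu hv, G.Reachable (⟨u, hu⟩ : C) ⟨v, hv⟩ := by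
    intro u v huv
    rw [Setoid.sup_eq_eqvGen] at huv
    induction huv with
    | rel a b h =>
      intro ha hb
      by_cases hab : a = b
      · subst hab; exact SimpleGraph.Reachable.refl _
      · refine SimpleGraph.Adj.reachable ?_
        rw [SimpleGraph.fromRel_adj]
        exact ⟨fun h' => hab (congrArg Subtype.val h'), .inl h⟩
    | refl a => intro _ _; exact SimpleGraph.Reachable.refl _
    | symm a b _ ih => intro ha hb; exact (ih hb ha).symm
    | trans a b d hab _ ih1 ih2 =>
      intro ha hd
      have hb : (r ⊔ s) c b := by
        refine (r ⊔ s).trans ha ?_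
        rw [Setoid.sup_eq_eqvGen]
        exact hab
      exact (ih1 ha hb).trans (ih2 hb hd)
  have hnt : Nontrivial C := by
    obtain ⟨w, hw, hcw⟩ := hr c
    exact ⟨⟨⟨c, (r ⊔ s).refl c⟩, ⟨w, sup_left hcw⟩, fun h => hw (congrArg Subtype.val h).symm⟩⟩
  have hconn : G.Connected :=
    ⟨fun u v => hreach u v ((r ⊔ s).trans ((r ⊔ s).symm u.2) v.2) u.2 v.2⟩
  -- A finite connected graph with at least two vertices has a vertex that is not a cut vertex.
  obtain ⟨⟨x, hx⟩, hxG⟩ :=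
    hconn.exists_connected_induce_compl_singleton_of_finite_nontrivial
  refine ⟨x, hx, fun y hy => ?_⟩
  set s' := s.comap (Equiv.swap x y) with hs'
  have hxy : x ≠ y := fun h => hy (h ▸ hx)
  have hfix : ∀ u v, u ≠ x → u ≠ y → v ≠ x → v ≠ y → s u v → s' u v := by
    intro u v h1 h2 h3 h4 h
    rw [hs', Setoid.comap_rel, Equiv.swap_apply_of_ne_of_ne h1 h2,
      Equiv.swap_apply_of_ne_of_ne h3 h4]
    exact h
  have hney : ∀ {u}, (r ⊔ s) c u → u ≠ y := fun hu h => hy (h ▸ hu)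
  have h1 : ∀ u v, (r ⊔ s) c u → (r ⊔ s) c v → u ≠ x → v ≠ x → (r ⊔ s') u v := by
    intro u v hu hv hux hvx
    have := hxG.preconnected ⟨⟨u, hu⟩, fun h => hux (congrArg Subtype.val h)⟩
      ⟨⟨v, hv⟩, fun h => hvx (congrArg Subtype.val h)⟩
    rw [SimpleGraph.reachable_iff_reflTransGen] at this
    have key : ∀ a b : ({⟨x, hx⟩}ᶜ : Set C),
        Relation.ReflTransGen (G.induce {⟨x, hx⟩}ᶜ).Adj a b → (r ⊔ s') a.1.1 b.1.1 := by
      intro a b hab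
      induction hab with
      | refl => exact (r ⊔ s').refl _
      | @tail b d _ hbd ih =>
        refine (r ⊔ s').trans ih ?_
        rw [SimpleGraph.induce_adj, SimpleGraph.fromRel_adj] at hbd
        have hb : b.1.1 ≠ x := fun h => b.2 (Subtype.ext h)
        have hd : d.1.1 ≠ x := fun h => d.2 (Subtype.ext h)
        rcases hbd.2 with (h | h) | (h | h)
        · exact sup_left h
        · exact sup_right (hfix _ _ hb (hney b.1.2) hd (hney d.1.2) h)
        · exact sup_left (r.symm h)
        · exact sup_right (hfix _ _ hb (hney b.1.2) hd (hney d.1.2) (s.symm h))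
    exact key _ _ this
  -- The `r`-neighbour `p` keeps `x` attached to its old class; `y` takes the place of `x` in the
  -- `s`-class of `q`, and so joins that class.
  obtain ⟨p, hpx, hp⟩ := hr x
  obtain ⟨q, hqx, hq⟩ := hs x
  have hpC : (r ⊔ s) c p := (r ⊔ s).trans hx (sup_left hp)
  have hqC : (r ⊔ s) c q := (r ⊔ s).trans hx (sup_right hq)
  have h2 : ∀ u, (r ⊔ s) c u → (r ⊔ s') x u := by
    intro u hu
    by_cases hux : u = x
    · subst hux; exact (r ⊔ s').refl _
    · exact (r ⊔ s').trans (sup_left hp) (h1 p u hpC hu hpx hux)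
  have hyq : s' y q := by
    rw [hs', Setoid.comap_rel, Equiv.swap_apply_right,
      Equiv.swap_apply_of_ne_of_ne hqx (hney hqC)]
    exact hq
  have h3 : (r ⊔ s') x y := (r ⊔ s').trans (h2 q hqC) ((r ⊔ s').symm (sup_right hyq))
  -- The other points of the old `s`-class of `y` are now related to `x`, which is already joined to
  -- `y`.
  have h4 : ∀ w, ¬ (r ⊔ s) c w → s y w → (r ⊔ s') y w := by
    intro w hw hyw
    by_cases hwy : w = y
    · subst hwy; exact (r ⊔ s').refl _
    · have hwx : w ≠ x := fun h => hw (h ▸ hx)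
      refine (r ⊔ s').trans ((r ⊔ s').symm h3) (sup_right ?_)
      rw [hs', Setoid.comap_rel, Equiv.swap_apply_left, Equiv.swap_apply_of_ne_of_ne hwx hwy]
      exact hyw
  refine lt_of_le_of_ne (sup_le le_sup_left fun u v huv => ?_) fun heq => hy ?_
  · by_cases hu : (r ⊔ s) c u
    · have hv : (r ⊔ s) c v := (r ⊔ s).trans hu (sup_right huv)
      exact (r ⊔ s').trans ((r ⊔ s').symm (h2 u hu)) (h2 v hv)
    · have hv : ¬ (r ⊔ s) c v := fun hv => hu ((r ⊔ s).trans hv (sup_right (s.symm huv)))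
      by_cases huy : u = y
      · subst huy; exact h4 v hv huv
      · by_cases hvy : v = y
        · subst hvy; exact (r ⊔ s').symm (h4 u hu (s.symm huv))
        · exact sup_right (hfix u v (fun h => hu (h ▸ hx)) huy (fun h => hv (h ▸ hx)) hvy huv)
  · rw [← heq] at h3
    exact (r ⊔ s).trans hx h3

open Classical in
/-- Two equivalence relations without singleton classes can be made to generate the trivial
relation by a permutation that changes the colour of boundedly many points only. -/
theorem Setoid.exists_perm_sup_comap_eq_top [Finite V] [Finite L] (r s : Setoid V)
    (hr : ∀ v, ∃ w, w ≠ v ∧ r v w) (hs : ∀ v, ∃ w, w ≠ v ∧ s v w) (d : V → L) :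
    ∃ π : Equiv.Perm V, {v | d (π v) ≠ d v}.ncard ≤ 3 * Nat.card L ∧ r ⊔ s.comap π = ⊤ := by
  have hs' : ∀ (π : Equiv.Perm V) v, ∃ w, w ≠ v ∧ s.comap π v w := by
    intro π v
    obtain ⟨w, hw, hvw⟩ := hs (π v)
    exact ⟨π.symm w, fun h => hw (by rw [← h, Equiv.apply_symm_apply]), by
      rwa [Setoid.comap_rel, Equiv.apply_symm_apply]⟩
  let comps : Equiv.Perm V → ℕ := fun π => Nat.card (Quotient (r ⊔ s.comap π))
  have hstep : ∀ (π : Equiv.Perm V) c, ∃ x, (r ⊔ s.comap π) c x ∧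
      ∀ y, ¬ (r ⊔ s.comap π) c y → comps (π * Equiv.swap x y) < comps π := by
    intro π c
    obtain ⟨x, hx, hxy⟩ := exists_lt_sup_comap_swap r (s.comap π) hr (hs' π) c
    exact ⟨x, hx, fun y hy => card_quotient_lt (hxy y hy)⟩
  obtain ⟨π₀, hπ₀, hmin₀⟩ := exists_min_image {π : Equiv.Perm V | ∀ v, d (π v) = d v} comps
    (toFinite _) ⟨1, fun _ => rfl⟩
  -- The chosen points of distinct components have distinct colours: swapping two of equal colour
  -- would preserve colours and lower the minimum.
  have hcomp : comps π₀ ≤ Nat.card L := by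
    choose x hx hxy using hstep π₀
    refine Nat.card_le_card_of_injective
      (fun q : Quotient (r ⊔ s.comap π₀) => d (x q.out)) fun q q' hqq' => ?_
    by_contra hne
    have hout : ¬ (r ⊔ s.comap π₀) q.out (x q'.out) := by
      intro h
      apply hne
      rw [← Quotient.out_eq q, ← Quotient.out_eq q']
      exact Quotient.sound ((r ⊔ s.comap π₀).trans h ((r ⊔ s.comap π₀).symm (hx q'.out)))
    refine (hxy _ _ hout).not_ge (hmin₀ _ fun v => ?_)
    rw [Equiv.Perm.mul_apply, hπ₀, Equiv.swap_apply_def]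
    split_ifs with h1 h2
    · rw [h1]; exact hqq'.symm
    · rw [h2]; exact hqq'
    · rfl
  -- A merging swap removes a component and recolours at most two more points, so weight 3 forces a
  -- minimiser to have a single component. Comparison with `π₀` bounds the recolouring.
  obtain ⟨π, hmin⟩ := Finite.exists_min
    fun π : Equiv.Perm V => 3 * comps π + {v | d (π v) ≠ d v}.ncard
  refine ⟨π, ?_, ?_⟩
  · have := hmin π₀
    have h0 : {v | d (π₀ v) ≠ d v} = ∅ := by ext v; simpa using hπ₀ v
    rw [h0, ncard_empty] at this
    omega
  · by_contra htop
    obtain ⟨c, y, hcy⟩ : ∃ c y, ¬ (r ⊔ s.comap π) c y := by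
      by_contra! h
      exact htop (top_le_iff.1 fun a b _ => h a b)
    obtain ⟨x, -, hxy⟩ := hstep π c
    have h1 := hxy y hcy
    have h2 := hmin (π * Equiv.swap x y)
    have h3 : {v | d ((π * Equiv.swap x y) v) ≠ d v}.ncard ≤ {v | d (π v) ≠ d v}.ncard + 2 := by
      refine (ncard_le_ncard (t := {v | d (π v) ≠ d v} ∪ {x, y}) (fun v hv => ?_)
        (toFinite _)).trans ((ncard_union_le _ _).trans
          (Nat.add_le_add_left (ncard_insert_le _ _ |>.trans (by simp)) _))
      by_cases h1 : v = x
      · simp [h1]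
      · by_cases h2 : v = y
        · simp [h2]
        · left
          rwa [mem_ofPred_eq, Equiv.Perm.mul_apply, Equiv.swap_apply_of_ne_of_ne h1 h2] at hv
    omega

/-- The orbit equivalence relation of a homomorphism to a permutation group. -/
def orbitSetoid {Γ : Type*} [Group Γ] (σ : Γ →* Equiv.Perm V) : Setoid V where
  r v w := ∃ γ, σ γ v = w
  iseqv :=
    { refl := fun v => ⟨1, by simp⟩
      symm := by
        rintro v w ⟨γ, rfl⟩
        exact ⟨γ⁻¹, by rw [← Equiv.Perm.mul_apply, ← map_mul]; simp⟩
      trans := by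
        rintro u v w ⟨γ, rfl⟩ ⟨δ, rfl⟩
        exact ⟨δ * γ, by rw [map_mul, Equiv.Perm.mul_apply]⟩ }

end transitivity

/-! ### Matching two colourings -/

section matching

variable {V W L : Type*}

open Classical in
/-- Two colourings with nearly the same colour counts agree, up to few points, after a bijection. -/
theorem exists_equiv_ncard_ne_le [Finite V] [Finite W] [Fintype L] (e : V ≃ W)
    (d : V → L) (d' : W → L) :
    ∃ φ : V ≃ W, {v | d' (φ v) ≠ d v}.ncard ≤
      ∑ l, ({v | d v = l}.ncard - {w | d' w = l}.ncard) := by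
  have : Fintype V := Fintype.ofFinite V
  have : Fintype W := Fintype.ofFinite W
  have : Nonempty (V ≃ W) := ⟨e⟩
  obtain ⟨φ, hφ⟩ := Finite.exists_min fun φ : V ≃ W => {v | d' (φ v) ≠ d v}.ncard
  refine ⟨φ, ?_⟩
  have hsum : {v | d' (φ v) ≠ d v}.ncard = ∑ l, {v | d' (φ v) ≠ d v ∧ d v = l}.ncard := by
    simp only [ncard_eq_toFinset_card', toFinset_ofPred]
    rw [Finset.card_eq_sum_card_fiberwise (f := d) (t := Finset.univ) (fun _ _ => by simp)]
    simp only [Finset.filter_filter]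
  rw [hsum]
  refine Finset.sum_le_sum fun l _ => ?_
  by_cases hex : ∃ v, d' (φ v) ≠ d v ∧ d v = l
  · obtain ⟨v, hv, hvl⟩ := hex
    -- Otherwise exchanging the partners of `v` and `w` would repair `v` without spoiling `w`, which
    -- was mismatched already. Hence the mismatches of colour `l` number exactly the surplus.
    have hall : ∀ w, d' (φ w) = l → d w = l := by
      intro w hw
      by_contra hwl
      have hvw : v ≠ w := by rintro rfl; exact hwl hvl
      refine (hφ ((Equiv.swap v w).trans φ)).not_gt (ncard_lt_ncard ?_ (toFinite _))
      refine ⟨fun u hu => ?_, fun hsub => ?_⟩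
      · simp only [mem_ofPred_eq, Equiv.trans_apply] at hu ⊢
        by_cases h1 : u = v
        · subst h1; exact hv
        · by_cases h2 : u = w
          · subst h2; rw [hw]; exact fun h => hwl h.symm
          · rwa [Equiv.swap_apply_of_ne_of_ne h1 h2] at hu
      · have := hsub (show v ∈ {v | d' (φ v) ≠ d v} from hv)
        simp only [mem_ofPred_eq, Equiv.trans_apply, Equiv.swap_apply_left] at this
        exact this (hw.trans hvl.symm)
    have hpre : {w | d' w = l}.ncard = {v | d' (φ v) = l}.ncard := by
      rw [← ncard_preimage_of_injective_subset_range φ.injective (s := {w | d' w = l}) (by simp)]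
      rfl
    have hsub : {v | d' (φ v) = l} ⊆ {v | d v = l} := hall
    rw [hpre, ← ncard_sdiff hsub]
    refine ncard_le_ncard (fun u hu => ?_) (toFinite _)
    exact ⟨hu.2, fun h => hu.1 (h.trans hu.2.symm)⟩
  · have : {v | d' (φ v) ≠ d v ∧ d v = l} = ∅ := by
      ext v; simp only [mem_ofPred_eq, mem_empty_iff_false, iff_false]
      exact fun h => hex ⟨v, h⟩
    rw [this, ncard_empty]
    exact Nat.zero_le _

end matching

/-! ### Adjusting and reading finite models -/

section models

variable {Γ : Type*} [Group Γ]

/-- The product of two actions by permutations. -/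
def prodPerm {V W : Type*} (σ : Γ →* Equiv.Perm V) (ρ : Γ →* Equiv.Perm W) :
    Γ →* Equiv.Perm (V × W) where
  toFun γ := Equiv.prodCongr (σ γ) (ρ γ)
  map_one' := by ext x <;> simp
  map_mul' γ δ := by ext x <;> simp

/-- Finite models may be taken without fixed points, and of all large multiples of some size. -/
theorem FinitelyApproximable.exists_card_eq (hΓ : FinitelyApproximable Γ) {W : Type} [Finite W]
    [Nonempty W] (ρ : Γ →* Equiv.Perm W) (hρ : ∀ w, ∃ γ, ρ γ w ≠ w)
    {X : Type} [MeasurableSpace X] [StandardBorelSpace X] {μ : Measure X} [IsProbabilityMeasure μ]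
    (a : MPAction Γ μ) {K : Type} [Finite K] (c : X → K) (hc : ∀ i, MeasurableSet (c ⁻¹' {i}))
    (F : Finset Γ) {ε : ℝ} (hε : 0 < ε) :
    ∃ N, 0 < N ∧ ∀ m, 0 < m → ∃ (V : Type) (_ : Finite V) (_ : Nonempty V)
      (σ : Γ →* Equiv.Perm V) (d : V → K), Nat.card V = N * m ∧ (∀ v, ∃ γ, σ γ v ≠ v) ∧
        a.Approximates c F ε σ d := by
  obtain ⟨V, _, _, σ, d, h⟩ := hΓ X μ a K c hc F ε hε
  refine ⟨Nat.card V * Nat.card W, Nat.mul_pos Nat.card_pos Nat.card_pos, fun m hm => ?_⟩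
  have : Nonempty (Fin m) := ⟨⟨0, hm⟩⟩
  -- The factor `W` destroys fixed points and the trivial factor `Fin m` tunes the size; colours
  -- come from `V` alone, so the statistics are unchanged.
  refine ⟨V × (W × Fin m), inferInstance, inferInstance, prodPerm σ (prodPerm ρ 1),
    fun v => d v.1, ?_, ?_, ?_⟩
  · simp [mul_assoc]
  · rintro ⟨v, w, t⟩
    obtain ⟨γ, hγ⟩ := hρ w
    exact ⟨γ, fun h => hγ (congrArg (fun p => p.2.1) h)⟩
  · intro γ hγ i j
    have := freq_comp_fst (W := W × Fin m) fun v => d v = i ∧ d (σ γ v) = j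
    exact this ▸ h γ hγ i j

variable {X : Type*} [MeasurableSpace X] {μ : Measure X}

theorem MPAction.Approximates.abs_sub_lt_one {a : MPAction Γ μ} {K V : Type*} {c : X → K}
    {F : Finset Γ} {ε : ℝ} {σ : Γ →* Equiv.Perm V} {d : V → K} (h : a.Approximates c F ε σ d)
    (h1 : 1 ∈ F) (i : K) : |μ.real {x | c x = i} - freq (fun v => d v = i)| < ε := by
  simpa using h 1 h1 i i

/-- Statistics that are excluded for the action are rare in the model. -/
theorem MPAction.Approximates.freq_le {a : MPAction Γ μ} {K V : Type*} [Finite V] [Fintype K]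
    {c : X → K} {F : Finset Γ} {ε : ℝ} {σ : Γ →* Equiv.Perm V} {d : V → K}
    (h : a.Approximates c F ε σ d) {γ : Γ} (hγ : γ ∈ F) (hε : 0 ≤ ε)
    (Q : K → K → Prop) (hQ : ∀ x, ¬ Q (c x) (c (a.toHom γ x))) :
    freq (fun v => Q (d v) (d (σ γ v))) ≤ (Fintype.card K : ℝ) ^ 2 * ε := by
  classical
  rw [freq_comp_eq_sum (fun v => (d v, d (σ γ v))) fun p => Q p.1 p.2]
  calc _ ≤ ∑ p : K × K with Q p.1 p.2, ε := by
        refine Finset.sum_le_sum fun p hp => ?_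
        have hp' : Q p.1 p.2 := (Finset.mem_filter.1 hp).2
        have := h γ hγ p.1 p.2
        have hempty : {x | c x = p.1 ∧ c (a.toHom γ x) = p.2} = ∅ := by
          ext x
          simp only [mem_ofPred_eq, mem_empty_iff_false, iff_false]
          rintro ⟨h1, h2⟩
          exact hQ x (h1 ▸ h2 ▸ hp')
        rw [hempty, measureReal_empty, zero_sub, abs_neg] at this
        simp only [Prod.ext_iff]
        exact (le_abs_self _).trans this.le
    _ ≤ ∑ p : K × K, ε :=
        Finset.sum_le_sum_of_subset_of_nonneg (Finset.subset_univ _) fun _ _ _ => hε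
    _ = _ := by simp [sq]

/-- Events that depend on one colour have nearly the right frequency in the model. -/
theorem MPAction.Approximates.abs_sub_le [IsFiniteMeasure μ] {a : MPAction Γ μ} {K V : Type*} [Finite V] [Fintype K]
    {c : X → K} (hc : ∀ i, MeasurableSet (c ⁻¹' {i})) {F : Finset Γ} {ε : ℝ}
    {σ : Γ →* Equiv.Perm V} {d : V → K} (h : a.Approximates c F ε σ d) (h1 : 1 ∈ F) (hε : 0 ≤ ε)
    (Q : K → Prop) :
    |μ.real {x | Q (c x)} - freq (fun v => Q (d v))| ≤ Fintype.card K * ε := by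
  classical
  rw [freq_comp_eq_sum, measureReal_comp_eq_sum μ c hc, ← Finset.sum_sub_distrib]
  calc _ ≤ ∑ l with Q l, |μ.real {x | c x = l} - freq (fun v => d v = l)| :=
        Finset.abs_sum_le_sum_abs _ _
    _ ≤ ∑ l with Q l, ε := Finset.sum_le_sum fun l _ => (h.abs_sub_lt_one h1 l).le
    _ ≤ ∑ l : K, ε :=
        Finset.sum_le_sum_of_subset_of_nonneg (Finset.subset_univ _) fun _ _ _ => hε
    _ = _ := by simp

end models

/-! ### Gluing models over the free product -/

section coprod

variable {Γ₁ Γ₂ : Type*} [Group Γ₁] [Group Γ₂]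

/-- A letter as an element of the free product. -/
def letterOf : Γ₁ ⊕ Γ₂ → Monoid.Coprod Γ₁ Γ₂ :=
  Sum.elim Monoid.Coprod.inl Monoid.Coprod.inr

/-- The failure of equivariance of a labelling by functions on the free product is controlled by
its failure at finitely many letters. -/
theorem exists_freq_ne_le_sum (γ u : Monoid.Coprod Γ₁ Γ₂) :
    ∃ T : List ((Γ₁ ⊕ Γ₂) × Monoid.Coprod Γ₁ Γ₂), ∀ (V K : Type) [Finite V]
      (σ : Monoid.Coprod Γ₁ Γ₂ →* Equiv.Perm V) (D : V → Monoid.Coprod Γ₁ Γ₂ → K),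
      freq (fun v => D (σ γ v) u ≠ D v (u * γ)) ≤
        (T.map fun t => freq fun v => D (σ (letterOf t.1) v) t.2 ≠ D v (t.2 * letterOf t.1)).sum := by
  -- Here `D v u` plays the role of the colour of `u v`. The list is independent of the model, so
  -- that the window can be fixed before the models are chosen.
  induction γ using Monoid.Coprod.induction_on generalizing u with
  | inl g => exact ⟨[(.inl g, u)], fun V K _ σ D => by simp [letterOf]⟩
  | inr g => exact ⟨[(.inr g, u)], fun V K _ σ D => by simp [letterOf]⟩
  | mul γ δ hγ hδ =>
    obtain ⟨T, hT⟩ := hγ u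
    obtain ⟨T', hT'⟩ := hδ (u * γ)
    refine ⟨T ++ T', fun V K _ σ D => ?_⟩
    rw [List.map_append, List.sum_append]
    refine le_trans ?_ (add_le_add (hT V K σ D) (hT' V K σ D))
    -- The error for `γ` is read at `σ δ v`; since `σ δ` is a bijection, its frequency does not
    -- change.
    rw [← freq_comp_equiv (σ δ) fun v => D (σ γ v) u ≠ D v (u * γ)]
    refine freq_le_add fun v hv => ?_
    by_contra! h
    exact hv (by rw [map_mul, Equiv.Perm.mul_apply, h.1, h.2, mul_assoc])

open Classical in
/-- Two models of the same statistics, for actions of two groups, on sets of the same size and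
without fixed points, are glued along a bijection with a transitive result. -/
theorem exists_equiv_transitive {V₁ V₂ L : Type*} [Finite V₁] [Nonempty V₁] [Finite V₂] [Fintype L]
    (σ₁ : Γ₁ →* Equiv.Perm V₁) (σ₂ : Γ₂ →* Equiv.Perm V₂) (h₁ : ∀ v, ∃ γ, σ₁ γ v ≠ v)
    (h₂ : ∀ v, ∃ γ, σ₂ γ v ≠ v) (hcard : Nat.card V₁ = Nat.card V₂) (d₁ : V₁ → L) (d₂ : V₂ → L)
    {δ : ℝ} (hd : ∀ l, |freq (fun v => d₁ v = l) - freq (fun v => d₂ v = l)| ≤ δ) :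
    ∃ φ : V₁ ≃ V₂,
      freq (fun v => d₂ (φ v) ≠ d₁ v) ≤ Fintype.card L * δ + 3 * Fintype.card L / Nat.card V₁ ∧
      ∀ v w, ∃ γ, Monoid.Coprod.lift σ₁ (φ.symm.permCongrHom.toMonoidHom.comp σ₂) γ v = w := by
  obtain ⟨φ₀, hφ₀⟩ := exists_equiv_ncard_ne_le (Finite.card_eq.1 hcard).some d₁ d₂
  have hN : (0 : ℝ) < Nat.card V₁ := Nat.cast_pos.2 Nat.card_pos
  have hmis : freq (fun v => d₂ (φ₀ v) ≠ d₁ v) ≤ Fintype.card L * δ := by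
    rw [freq, div_le_iff₀ hN]
    calc _ ≤ ((∑ l, ({v | d₁ v = l}.ncard - {w | d₂ w = l}.ncard) : ℕ) : ℝ) :=
          Nat.cast_le.2 hφ₀
      _ ≤ ∑ l : L, δ * Nat.card V₁ := by
          rw [Nat.cast_sum]
          refine Finset.sum_le_sum fun l _ => ?_
          have h := hd l
          rw [freq, freq, ← hcard, ← sub_div, abs_div, abs_of_pos hN, div_le_iff₀ hN] at h
          have h0 : 0 ≤ δ * Nat.card V₁ := (abs_nonneg _).trans h
          rcases le_total {v | d₁ v = l}.ncard {w | d₂ w = l}.ncard with hle | hle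
          · rw [Nat.sub_eq_zero_of_le hle]; simpa using h0
          · rw [Nat.cast_sub hle]; exact (le_abs_self _).trans h
      _ = _ := by simp [mul_assoc]
  obtain ⟨π, hπ, htop⟩ := Setoid.exists_perm_sup_comap_eq_top (orbitSetoid σ₁)
    ((orbitSetoid σ₂).comap φ₀) (fun v => (h₁ v).imp' (fun γ => σ₁ γ v) fun γ h => ⟨h, γ, rfl⟩)
    (fun v => (h₂ (φ₀ v)).imp' (fun γ => φ₀.symm (σ₂ γ (φ₀ v))) fun γ h =>
      ⟨fun h' => h (φ₀.symm_apply_eq.1 h'), γ, by simp⟩) d₁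
  refine ⟨π.trans φ₀, ?_, ?_⟩
  · have h1 : freq (fun v => d₁ (π v) ≠ d₁ v) ≤ 3 * Fintype.card L / Nat.card V₁ := by
      unfold freq
      gcongr
      rw [← Nat.card_eq_fintype_card]
      exact_mod_cast hπ
    have h2 : freq (fun v => d₂ (φ₀ (π v)) ≠ d₁ (π v)) ≤ Fintype.card L * δ := by
      rwa [freq_comp_equiv π fun v => d₂ (φ₀ v) ≠ d₁ v]
    refine (freq_le_add fun v hv => ?_).trans (add_le_add h2 h1)
    by_contra! h
    exact hv (h.1.trans h.2)
  · set σ := Monoid.Coprod.lift σ₁ ((π.trans φ₀).symm.permCongrHom.toMonoidHom.comp σ₂)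
    have hle : orbitSetoid σ₁ ⊔ ((orbitSetoid σ₂).comap φ₀).comap π ≤ orbitSetoid σ := by
      refine sup_le ?_ ?_
      · rintro v w ⟨γ, rfl⟩
        exact ⟨Monoid.Coprod.inl γ, by simp [σ]⟩
      · rintro v w ⟨γ, h⟩
        refine ⟨Monoid.Coprod.inr γ, ?_⟩
        have : σ (Monoid.Coprod.inr γ) v = (π.trans φ₀).symm (σ₂ γ (φ₀ (π v))) := by simp [σ]
        rw [this, h]
        simp
    rw [htop] at hle
    exact fun v w => hle (show (⊤ : Setoid V₁) v w from trivial)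

open Classical in
/-- Finite approximability of two groups with fixed point free finite actions passes to transitive
approximability of their free product. -/
theorem FinitelyApproximable.coprod (h₁ : FinitelyApproximable Γ₁) (h₂ : FinitelyApproximable Γ₂)
    {W₁ W₂ : Type} [Finite W₁] [Nonempty W₁] [Finite W₂] [Nonempty W₂]
    (ρ₁ : Γ₁ →* Equiv.Perm W₁) (ρ₂ : Γ₂ →* Equiv.Perm W₂) (hρ₁ : ∀ w, ∃ γ, ρ₁ γ w ≠ w)
    (hρ₂ : ∀ w, ∃ γ, ρ₂ γ w ≠ w) : TransitivelyApproximable (Monoid.Coprod Γ₁ Γ₂) := by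
  intro X _ _ μ _ a K _ c hc F ε hε n
  have : Fintype K := Fintype.ofFinite K
  obtain ⟨x₀⟩ : Nonempty X := by
    by_contra h
    rw [not_nonempty_iff] at h
    exact IsProbabilityMeasure.ne_zero μ (Measure.eq_zero_of_isEmpty μ)
  choose T hT using fun γ : Monoid.Coprod Γ₁ Γ₂ => exists_freq_ne_le_sum γ 1
  let S : Finset ((Γ₁ ⊕ Γ₂) × Monoid.Coprod Γ₁ Γ₂) := F.biUnion fun γ => (T γ).toFinset
  -- The window: everything at which a label is read in the error estimates.
  let U : Finset (Monoid.Coprod Γ₁ Γ₂) :=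
    insert 1 (F ∪ S.image (fun t => t.2) ∪ S.image (fun t => t.2 * letterOf t.1))
  have hU1 : (1 : Monoid.Coprod Γ₁ Γ₂) ∈ U := Finset.mem_insert_self _ _
  have hUF : ∀ γ ∈ F, γ ∈ U := fun γ hγ => by simp [U, hγ]
  have hUS : ∀ t ∈ S, t.2 ∈ U := fun t ht =>
    Finset.mem_insert_of_mem (Finset.mem_union_left _
      (Finset.mem_union_right _ (Finset.mem_image_of_mem _ ht)))
  have hUS' : ∀ t ∈ S, t.2 * letterOf t.1 ∈ U := fun t ht =>
    Finset.mem_insert_of_mem (Finset.mem_union_right _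
      (Finset.mem_image.2 ⟨t, ht, rfl⟩))
  let F₁ : Finset Γ₁ := insert 1 ((S.image Prod.fst).preimage Sum.inl Sum.inl_injective.injOn)
  let F₂ : Finset Γ₂ := insert 1 ((S.image Prod.fst).preimage Sum.inr Sum.inr_injective.injOn)
  have hF₁ : ∀ g u, (Sum.inl g, u) ∈ S → g ∈ F₁ := fun g u h =>
    Finset.mem_insert_of_mem (Finset.mem_preimage.2 (Finset.mem_image.2 ⟨_, h, rfl⟩))
  have hF₂ : ∀ g u, (Sum.inr g, u) ∈ S → g ∈ F₂ := fun g u h =>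
    Finset.mem_insert_of_mem (Finset.mem_preimage.2 (Finset.mem_image.2 ⟨_, h, rfl⟩))
  obtain ⟨ν⟩ : Nonempty (U ≃ Fin U.card) := ⟨U.equivFin⟩
  let e : X → (Fin U.card → K) := fun x u => c (a.toHom (ν.symm u) x)
  have he : ∀ l, MeasurableSet (e ⁻¹' {l}) := by
    intro l
    have : e ⁻¹' {l} = ⋂ u, a.toHom (ν.symm u) ⁻¹' (c ⁻¹' {l u}) := by
      ext x; simp [e, funext_iff]
    rw [this]
    exact MeasurableSet.iInter fun u => (a.measurePreserving _).measurable (hc _)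
  obtain ⟨q, hq⟩ : ∃ q : ℝ, q = ((Fintype.card (Fin U.card → K) : ℕ) : ℝ) := ⟨_, rfl⟩
  have hq0 : 0 ≤ q := hq ▸ Nat.cast_nonneg _
  obtain ⟨B, hB⟩ : ∃ B : ℝ, B = ∑ γ ∈ F, ((T γ).length : ℝ) := ⟨_, rfl⟩
  have hB0 : 0 ≤ B := hB ▸ Finset.sum_nonneg fun _ _ => Nat.cast_nonneg _
  have hBγ : ∀ γ ∈ F, ((T γ).length : ℝ) ≤ B := fun γ hγ => hB ▸
    Finset.single_le_sum (f := fun γ => ((T γ).length : ℝ)) (fun _ _ => Nat.cast_nonneg _) hγ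
  -- The error budget in units of `δ`: `q` for one-point statistics, `q ^ 2 + 2 * (2 * q + 1)` for
  -- each of at most `B` letters, and 1 for strictness.
  obtain ⟨R, hR⟩ : ∃ R : ℝ, R = q + B * (q ^ 2 + 2 * (2 * q + 1)) + 1 := ⟨_, rfl⟩
  have hR0 : 0 < R := by rw [hR]; positivity
  obtain ⟨δ, hδ⟩ : ∃ δ : ℝ, δ = ε / R := ⟨_, rfl⟩
  have hδ0 : 0 < δ := hδ ▸ div_pos hε hR0
  obtain ⟨N₁, hN₁, hm₁⟩ := h₁.exists_card_eq ρ₁ hρ₁ (a.comap Monoid.Coprod.inl) e he F₁ hδ0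
  obtain ⟨N₂, hN₂, hm₂⟩ := h₂.exists_card_eq ρ₂ hρ₂ (a.comap Monoid.Coprod.inr) e he F₂ hδ0
  obtain ⟨M, hM⟩ := exists_nat_gt (max (n : ℝ) (3 * q / δ))
  have hM0 : 0 < M := by
    have : (0 : ℝ) < M := lt_of_le_of_lt (le_max_of_le_left (Nat.cast_nonneg n)) hM
    exact_mod_cast this
  obtain ⟨V₁, _, _, σ₁, d₁, hc₁, hf₁, ha₁⟩ := hm₁ (N₂ * M) (Nat.mul_pos hN₂ hM0)
  obtain ⟨V₂, _, _, σ₂, d₂, hc₂, hf₂, ha₂⟩ := hm₂ (N₁ * M) (Nat.mul_pos hN₁ hM0)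
  have hcard : Nat.card V₁ = Nat.card V₂ := by rw [hc₁, hc₂]; ring
  have hMcard : M ≤ Nat.card V₁ := by
    rw [hc₁, ← mul_assoc]
    exact Nat.le_mul_of_pos_left M (Nat.mul_pos hN₁ hN₂)
  have hF₁1 : 1 ∈ F₁ := Finset.mem_insert_self _ _
  have hF₂1 : 1 ∈ F₂ := Finset.mem_insert_self _ _
  -- Both models are `δ`-close to the same distribution of `e`, hence `2 * δ`-close to each other.
  obtain ⟨φ, hφ, htrans⟩ := exists_equiv_transitive σ₁ σ₂ hf₁ hf₂ hcard d₁ d₂ (δ := 2 * δ)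
    fun l => by
      have h1 := abs_lt.1 (ha₁.abs_sub_lt_one hF₁1 l)
      have h2 := abs_lt.1 (ha₂.abs_sub_lt_one hF₂1 l)
      exact abs_le.2 ⟨by linarith, by linarith⟩
  set τ := φ.symm.permCongrHom.toMonoidHom.comp σ₂ with hτ
  have hτa : ∀ g v, φ (τ g v) = σ₂ g (φ v) := fun g v => by simp [hτ]
  set σ := Monoid.Coprod.lift σ₁ τ with hσ
  obtain ⟨κ, hκ⟩ : ∃ κ : ℝ, κ = (2 * q + 1) * δ := ⟨_, rfl⟩
  have hmis : freq (fun v => d₂ (φ v) ≠ d₁ v) ≤ κ := by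
    refine hφ.trans ?_
    have hMR : 3 * q / δ < M := lt_of_le_of_lt (le_max_right _ _) hM
    have : 3 * q / Nat.card V₁ ≤ δ := by
      have h0 : (M : ℝ) ≤ Nat.card V₁ := by exact_mod_cast hMcard
      have h1 : (0 : ℝ) < Nat.card V₁ := Nat.cast_pos.2 Nat.card_pos
      rw [div_lt_iff₀ hδ0] at hMR
      rw [div_le_iff₀ h1]
      nlinarith
    rw [← hq]
    nlinarith
  refine ⟨V₁, inferInstance, inferInstance, σ, fun v => d₁ v (ν ⟨1, hU1⟩), ?_, htrans, ?_⟩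
  · refine le_trans ?_ hMcard
    have : (n : ℝ) < M := lt_of_le_of_lt (le_max_left _ _) hM
    exact_mod_cast this.le
  -- The value `c x₀` off the window is never read.
  let D : V₁ → Monoid.Coprod Γ₁ Γ₂ → K := fun v g => if h : g ∈ U then d₁ v (ν ⟨g, h⟩) else c x₀
  have hD : ∀ v g (h : g ∈ U), D v g = d₁ v (ν ⟨g, h⟩) := fun v g h => dif_pos h
  have hκ0 : 0 ≤ κ := by rw [hκ]; positivity
  have herr : ∀ t ∈ S, freq (fun v => D (σ (letterOf t.1) v) t.2 ≠ D v (t.2 * letterOf t.1)) ≤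
      q ^ 2 * δ + 2 * κ := by
    rintro ⟨s, u⟩ ht
    have hu := hUS _ ht
    have hus := hUS' _ ht
    simp only [hD _ _ hu, hD _ _ hus]
    rcases s with g | g
    · have := ha₁.freq_le (hF₁ g u ht) hδ0.le
        (fun l l' => l' (ν ⟨u, hu⟩) ≠ l (ν ⟨u * letterOf (Sum.inl g), hus⟩)) fun x => by
          simp [e, MPAction.comap, letterOf]
      have h : σ (letterOf (Sum.inl g)) = σ₁ g := by simp [hσ, letterOf]
      rw [← hq] at this
      rw [h]
      exact this.trans (by linarith)
    -- A letter of `Γ₂` is exact up to `q ^ 2 * δ` for `d₂`; passing to `d₁` costs one mismatch at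
    -- `v` and one at `τ g v`.
    · have h2 := ha₂.freq_le (hF₂ g u ht) hδ0.le
        (fun l l' => l' (ν ⟨u, hu⟩) ≠ l (ν ⟨u * letterOf (Sum.inr g), hus⟩)) fun x => by
          simp [e, MPAction.comap, letterOf]
      have h : σ (letterOf (Sum.inr g)) = τ g := by simp [hσ, letterOf]
      rw [h]
      rw [← hq, ← freq_comp_equiv φ] at h2
      have h3 : freq (fun v => d₂ (φ (τ g v)) ≠ d₁ (τ g v)) ≤ κ := by
        rwa [freq_comp_equiv (τ g) fun v => d₂ (φ v) ≠ d₁ v]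
      have h4 := freq_or_le (fun v => d₂ (φ (τ g v)) ≠ d₁ (τ g v)) (fun v => d₂ (φ v) ≠ d₁ v)
      refine (freq_le_add
        (r := fun v => d₂ (φ (τ g v)) ≠ d₁ (τ g v) ∨ d₂ (φ v) ≠ d₁ v) fun v hv => ?_).trans
        (add_le_add h2 (h4.trans (by linarith)))
      by_contra! hcon
      obtain ⟨hc1, hc2, hc3⟩ := hcon
      exact hv (by rw [← hc2, ← hc3, hτa, hc1])
  intro γ hγ i j
  have hγU := hUF γ hγ
  -- Since `e` records both `c x` and `c (γ x)`, the pair statistic is an event about a single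
  -- colour of `e`.
  have hA := ha₁.abs_sub_le he hF₁1 hδ0.le fun l => l (ν ⟨1, hU1⟩) = i ∧ l (ν ⟨γ, hγU⟩) = j
  have hsum : freq (fun v => D (σ γ v) 1 ≠ D v (1 * γ)) ≤ B * (q ^ 2 * δ + 2 * κ) := by
    refine (hT γ V₁ K σ D).trans ?_
    have hpos : 0 ≤ q ^ 2 * δ + 2 * κ := by positivity
    refine le_trans ?_ (mul_le_mul_of_nonneg_right (hBγ γ hγ) hpos)
    have := List.sum_le_card_nsmul ((T γ).map fun t =>
      freq fun v => D (σ (letterOf t.1) v) t.2 ≠ D v (t.2 * letterOf t.1))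
      (q ^ 2 * δ + 2 * κ) (by
        intro y hy
        obtain ⟨t, ht, rfl⟩ := List.mem_map.1 hy
        exact herr t (Finset.mem_biUnion.2 ⟨γ, hγ, List.mem_toFinset.2 ht⟩))
    simpa [mul_add] using this
  have hBq := abs_freq_sub_freq_le
    (p := fun v => d₁ v (ν ⟨1, hU1⟩) = i ∧ d₁ v (ν ⟨γ, hγU⟩) = j)
    (q := fun v => d₁ v (ν ⟨1, hU1⟩) = i ∧ d₁ (σ γ v) (ν ⟨1, hU1⟩) = j)
    (r := fun v => D (σ γ v) 1 ≠ D v (1 * γ)) fun v hv => by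
      rw [not_not, one_mul, hD _ _ hU1, hD _ _ hγU] at hv
      rw [hv]
  have hset : {x | e x (ν ⟨1, hU1⟩) = i ∧ e x (ν ⟨γ, hγU⟩) = j} = {x | c x = i ∧ c (a.toHom γ x) = j} := by
    simp [e]
  rw [hset, ← hq] at hA
  calc _ ≤ q * δ + B * (q ^ 2 * δ + 2 * κ) :=
        (abs_sub_le _ _ _).trans (add_le_add hA (hBq.trans hsum))
    _ = (R - 1) * δ := by rw [hR, hκ]; ring
    _ < R * δ := by nlinarith
    _ = ε := by rw [hδ]; field_simp

end coprod

/-! ### Weak containment through colourings; finite factors -/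

theorem exists_preimage_singleton_eq {X ι : Type*} (A : ι → Set X)
    (hdisj : Pairwise fun i j => Disjoint (A i) (A j)) (hcov : ⋃ i, A i = univ) :
    ∃ c : X → ι, ∀ i, c ⁻¹' {i} = A i := by
  have h : ∀ x, ∃ i, x ∈ A i := fun x => mem_iUnion.1 (hcov ▸ mem_univ x)
  choose c hc using h
  refine ⟨c, fun i => Set.ext fun x => ⟨?_, fun hx => ?_⟩⟩
  · rintro rfl
    exact hc x
  · by_contra hne
    exact (hdisj hne).le_bot ⟨hc x, hx⟩

/-- The shift action on functions on a set with a group action. -/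
def shiftHom {Γ S : Type*} [Group Γ] (ψ : Γ →* Equiv.Perm S) (K : Type*) :
    Γ →* Equiv.Perm (S → K) where
  toFun γ := Equiv.arrowCongr (ψ γ) (Equiv.refl K)
  map_one' := by rw [map_one]; rfl
  map_mul' γ δ := by rw [map_mul]; rfl

theorem shiftHom_apply {Γ S : Type*} [Group Γ] (ψ : Γ →* Equiv.Perm S) (K : Type*) (γ : Γ)
    (w : S → K) (s : S) : shiftHom ψ K γ w s = w (ψ γ⁻¹ s) := by
  rw [map_inv]; rfl

section colourings

variable {Γ : Type*} [Group Γ] {X Y : Type*} [MeasurableSpace X] [MeasurableSpace Y]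
  {μ : Measure X} {ν : Measure Y}

/-- Pulling back along `γ` preserves measure; this links the images in `WeaklyContained` to colour
pairs at `x` and `γ x`. -/
theorem MPAction.measureReal_image_inter (a : MPAction Γ μ) {K : Type*} {c : X → K}
    (hc : ∀ i, MeasurableSet (c ⁻¹' {i})) (γ : Γ) (i j : K) :
    μ.real (a.toHom γ '' (c ⁻¹' {i}) ∩ c ⁻¹' {j}) =
      μ.real {x | c x = i ∧ c (a.toHom γ x) = j} := by
  have himg : a.toHom γ '' (c ⁻¹' {i}) = a.toHom γ⁻¹ ⁻¹' (c ⁻¹' {i}) := by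
    rw [map_inv, ← Equiv.image_symm_eq_preimage]
    rfl
  have hmeas : MeasurableSet (a.toHom γ '' (c ⁻¹' {i}) ∩ c ⁻¹' {j}) := by
    rw [himg]
    exact ((a.measurePreserving γ⁻¹).measurable (hc i)).inter (hc j)
  rw [← (a.measurePreserving γ).measureReal_preimage hmeas.nullMeasurableSet]
  congr 1
  ext x
  simp

theorem MPAction.weaklyContained_iff (a : MPAction Γ μ) (b : MPAction Γ ν) :
    a.WeaklyContained b ↔ ∀ (k : ℕ) (c : X → Fin k), (∀ i, MeasurableSet (c ⁻¹' {i})) →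
      ∀ (F : Finset Γ) (ε : ℝ), 0 < ε → ∃ c' : Y → Fin k, (∀ i, MeasurableSet (c' ⁻¹' {i})) ∧
        ∀ γ ∈ F, ∀ i j, |μ.real {x | c x = i ∧ c (a.toHom γ x) = j} -
          ν.real {y | c' y = i ∧ c' (b.toHom γ y) = j}| < ε := by
  constructor
  · intro h k c hc F ε hε
    obtain ⟨B, hB, hdisj, hcov, h⟩ := h k (fun i => c ⁻¹' {i}) hc
      (fun i j hij => Disjoint.preimage c (by simpa using hij))
      (by ext; simp) F ε hε
    obtain ⟨c', hc'⟩ := exists_preimage_singleton_eq B hdisj hcov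
    have hm : ∀ i, MeasurableSet (c' ⁻¹' {i}) := fun i => hc' i ▸ hB i
    refine ⟨c', hm, fun γ hγ i j => ?_⟩
    rw [← a.measureReal_image_inter hc, ← b.measureReal_image_inter hm, hc', hc']
    exact h γ hγ i j
  · intro h k A hA hdisj hcov F ε hε
    obtain ⟨c, hc⟩ := exists_preimage_singleton_eq A hdisj hcov
    have hm : ∀ i, MeasurableSet (c ⁻¹' {i}) := fun i => hc i ▸ hA i
    obtain ⟨c', hm', h⟩ := h k c hm F ε hε
    refine ⟨fun i => c' ⁻¹' {i}, hm', fun i j hij => Disjoint.preimage c' (by simpa using hij),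
      by ext; simp, fun γ hγ i j => ?_⟩
    rw [b.measureReal_image_inter hm', ← hc, ← hc, a.measureReal_image_inter hm]
    exact h γ hγ i j

/-- The statistics of a colouring that factors through a finite action are approximated by
finite actions with the uniform measure. -/
theorem MPAction.exists_approximates_of_factor [IsProbabilityMeasure ν] (b : MPAction Γ ν)
    {W K : Type*} [Finite W] (ρ : Γ →* Equiv.Perm W) (e : Y → W)
    (he : ∀ w, MeasurableSet (e ⁻¹' {w})) (heq : ∀ γ y, e (b.toHom γ y) = ρ γ (e y))
    (f : W → K) {ε : ℝ} (hε : 0 < ε) :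
    ∃ (V : Type) (_ : Finite V) (_ : Nonempty V) (σ : Γ →* Equiv.Perm V) (d : V → K),
      ∀ F, b.Approximates (fun y => f (e y)) F ε σ d := by
  classical
  obtain ⟨N, ⟨θ⟩⟩ := Finite.exists_equiv_fin W
  let e' : Y → Fin N := fun y => θ (e y)
  have he' : ∀ w, MeasurableSet (e' ⁻¹' {w}) := fun w => by
    have : e' ⁻¹' {w} = e ⁻¹' {θ.symm w} := by
      ext y; simp [e', Equiv.eq_symm_apply]
    exact this ▸ he _
  let ρ' : Γ →* Equiv.Perm (Fin N) := θ.permCongrHom.toMonoidHom.comp ρ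
  have heq' : ∀ γ y, e' (b.toHom γ y) = ρ' γ (e' y) := fun γ y => by simp [e', ρ', heq]
  -- Equivariance of `e'` makes the image of `ν` an invariant probability vector.
  obtain ⟨V, _, _, σ, π, hσ, h⟩ := exists_uniform_model ρ' (fun w => ν.real {y | e' y = w})
    (fun w => measureReal_nonneg)
    (by
      have := measureReal_comp_eq_sum ν e' he' fun _ => True
      simpa using this.symm)
    (fun γ w => by
      have hpre := (b.measurePreserving γ).measureReal_preimage (he' (ρ' γ w)).nullMeasurableSet
      refine hpre.symm.trans ?_
      congr 1
      ext y
      change e' (b.toHom γ y) = ρ' γ w ↔ e' y = w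
      rw [heq', (ρ' γ).apply_eq_iff_eq]) hε
  refine ⟨V, inferInstance, inferInstance, σ, fun v => f (θ.symm (π v)), fun F γ _ i j => ?_⟩
  have := h fun w => f (θ.symm w) = i ∧ f (θ.symm (ρ' γ w)) = j
  rw [← measureReal_comp_eq_sum ν e' he'] at this
  simpa only [← heq', hσ, e', Equiv.symm_apply_apply] using this

end colourings

/-- Finite groups are finitely approximable. -/
theorem FinitelyApproximable.of_finite (Γ : Type*) [Group Γ] [Finite Γ] :
    FinitelyApproximable Γ := by
  intro X _ _ μ _ a K _ c hc F ε hε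
  -- The itinerary `g ↦ c (g⁻¹ x)` is an equivariant map to a finite shift, and `c` is its
  -- coordinate at 1.
  obtain ⟨V, hV, hV', σ, d, h⟩ := a.exists_approximates_of_factor
    (shiftHom (MulAction.toPermHom Γ Γ) K)
    (fun x g => c (a.toHom g⁻¹ x)) (fun w => by
      have : (fun x g => c (a.toHom g⁻¹ x)) ⁻¹' {w} = ⋂ g, a.toHom g⁻¹ ⁻¹' (c ⁻¹' {w g}) := by
        ext x; simp [funext_iff]
      rw [this]
      exact MeasurableSet.iInter fun g => (a.measurePreserving _).measurable (hc _))
    (fun γ x => by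
      ext g
      rw [shiftHom_apply, ← Equiv.Perm.mul_apply, ← map_mul]
      simp) (fun w => w 1) hε
  refine ⟨V, hV, hV', σ, d, ?_⟩
  simpa using h F

/-! ### Fixed point free finite actions -/

section Bernoulli

variable (Γ : Type*) [Group Γ] [Countable Γ]

/-- The left translation action on a small copy of the group. -/
noncomputable def shrinkHom : Γ →* Equiv.Perm (Shrink.{0} Γ) :=
  (equivShrink.{0} Γ).permCongrHom.toMonoidHom.comp (MulAction.toPermHom Γ Γ)

/-- The Bernoulli shift of a countable group with base the uniform measure on `Bool`. -/
noncomputable def bernoulliShift : MPAction Γ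
    (Measure.infinitePi fun _ : Shrink.{0} Γ => (PMF.uniformOfFintype Bool).toMeasure) where
  toHom := shiftHom (shrinkHom Γ) Bool
  measurePreserving γ := by
    have h := Measure.infinitePi_map_piCongrLeft
      (μ := fun _ : Shrink.{0} Γ => (PMF.uniformOfFintype Bool).toMeasure) (shrinkHom Γ γ)
    have hs : ⇑(shiftHom (shrinkHom Γ) Bool γ) =
        MeasurableEquiv.piCongrLeft (fun _ => Bool) (shrinkHom Γ γ) := by
      ext w g
      rw [MeasurableEquiv.coe_piCongrLeft]
      obtain ⟨g, rfl⟩ := (shrinkHom Γ γ).surjective g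
      rw [Equiv.piCongrLeft_apply_apply, shiftHom_apply, ← Equiv.Perm.mul_apply, ← map_mul]
      simp
    refine ⟨?_, ?_⟩
    · exact hs ▸ (MeasurableEquiv.piCongrLeft (fun _ => Bool) (shrinkHom Γ γ)).measurable
    · exact (congrArg (fun f => Measure.map f _) hs).trans h

/-- A nontrivial countable finitely approximable group has a fixed point free finite action. -/
theorem FinitelyApproximable.exists_fixedPointFree [Nontrivial Γ] (h : FinitelyApproximable Γ) :
    ∃ (W : Type) (_ : Finite W) (_ : Nonempty W) (ρ : Γ →* Equiv.Perm W),
      ∀ w, ∃ γ, ρ γ w ≠ w := by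
  classical
  have : Countable (Shrink.{0} Γ) := (equivShrink.{0} Γ).symm.injective.countable
  obtain ⟨γ, hγ⟩ := exists_ne (1 : Γ)
  set μ := Measure.infinitePi fun _ : Shrink.{0} Γ => (PMF.uniformOfFintype Bool).toMeasure with hμ
  let s : Shrink.{0} Γ := equivShrink.{0} Γ 1
  let s' : Shrink.{0} Γ := equivShrink.{0} Γ γ⁻¹
  have hss : s' ≠ s := fun h => hγ (by simpa using (equivShrink.{0} Γ).injective h)
  set A := {x : Shrink.{0} Γ → Bool | x s = true ∧ (bernoulliShift Γ).toHom γ x s = false} with hA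
  have hA' : A = Set.pi ({s, s'} : Finset (Shrink.{0} Γ)) fun t => {decide (t = s)} := by
    ext x
    have : (bernoulliShift Γ).toHom γ x s = x s' := by
      refine (shiftHom_apply _ _ _ _ _).trans ?_
      simp [shrinkHom, s, s']
    simp [hA, this, hss]
  have hpos : 0 < μ.real A := by
    rw [measureReal_def, ENNReal.toReal_pos_iff]
    refine ⟨?_, measure_lt_top _ _⟩
    rw [hA', hμ, Measure.infinitePi_pi _ (fun _ _ => measurableSet_singleton _), pos_iff_ne_zero,
      Finset.prod_ne_zero_iff]
    intro t _
    rw [PMF.toMeasure_apply_singleton _ _ (measurableSet_singleton _)]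
    simp
  -- With tolerance `μ.real A`, the event `A` must occur in the model, so `γ` acts nontrivially
  -- there. Translation by `σ γ` on the finite group `σ.range` then moves every point.
  obtain ⟨V, _, _, σ, d, hd⟩ := h _ μ (bernoulliShift Γ) Bool (fun x => x s)
    (fun i => measurable_pi_apply s (measurableSet_singleton i)) {γ} _ hpos
  have hσ : σ γ ≠ 1 := by
    intro h1
    have := hd γ (Finset.mem_singleton_self _) true false
    have h0 : freq (fun v => d v = true ∧ d (σ γ v) = false) = 0 := by
      have : ∀ v, ¬ (d v = true ∧ d (σ γ v) = false) := fun v => by simp [h1]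
      simp [freq, this]
    rw [h0, sub_zero, abs_of_nonneg measureReal_nonneg] at this
    exact lt_irrefl _ this
  refine ⟨σ.range, inferInstance, inferInstance,
    (MulAction.toPermHom σ.range σ.range).comp σ.rangeRestrict, fun w => ⟨γ, fun hw => hσ ?_⟩⟩
  have : σ γ * (w : Equiv.Perm V) = w := congrArg Subtype.val hw
  exact mul_eq_right.1 this

end Bernoulli

/-! ### Approximation by sets invariant under open subgroups -/

section cylinders

open scoped Pointwise ENNReal
open Filter Topology

variable {T G : Type*} [MeasurableSpace T] [Group G] [TopologicalSpace G] [MeasurableSpace G]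

/-- Measurable subsets of `T × G` invariant under right translation of the second coordinate by
some open subgroup. -/
def IsOpenInvariant (S : Set (T × G)) : Prop :=
  MeasurableSet S ∧ ∃ O : OpenSubgroup G, ∀ t h, ∀ o ∈ O, (t, h * o) ∈ S ↔ (t, h) ∈ S

theorem IsOpenInvariant.compl {S : Set (T × G)} (h : IsOpenInvariant S) : IsOpenInvariant Sᶜ := by
  obtain ⟨hm, O, hO⟩ := h
  exact ⟨hm.compl, O, fun t g o ho => not_congr (hO t g o ho)⟩

theorem IsOpenInvariant.empty : IsOpenInvariant (∅ : Set (T × G)) :=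
  ⟨.empty, ⊤, fun _ _ _ _ => Iff.rfl⟩

theorem IsOpenInvariant.biUnion {ι : Type*} (s : Finset ι) {S : ι → Set (T × G)}
    (h : ∀ i, IsOpenInvariant (S i)) : IsOpenInvariant (⋃ i ∈ s, S i) := by
  choose hm O hO using h
  refine ⟨Finset.measurableSet_biUnion s fun i _ => hm i, s.inf O, fun t g o ho => ?_⟩
  simp only [mem_iUnion, exists_prop]
  exact exists_congr fun i => and_congr_right fun hi => hO i t g o (Finset.inf_le (f := O) hi ho)

variable [IsTopologicalGroup G] [CompactSpace G] [TotallyDisconnectedSpace G] [T2Space G] [BorelSpace G]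

/-- A measurable subset of a profinite group is nearly a union of cosets of an open subgroup. -/
theorem exists_isOpenInvariant_symmDiff_prod_le (τ : Measure T) [IsProbabilityMeasure τ]
    (m : Measure G) [IsProbabilityMeasure m] [m.Regular] {A : Set T} (hA : MeasurableSet A)
    {B : Set G} (hB : MeasurableSet B) {ε : ℝ≥0∞} (hε : ε ≠ 0) :
    ∃ S : Set (T × G), IsOpenInvariant S ∧ (τ.prod m) (symmDiff (A ×ˢ B) S) ≤ ε := by
  have hε2 : ε / 2 ≠ 0 := by simpa using hε
  -- Regularity gives a compact `K` inside `B` and an open `U` around `K`; for a small open subgroup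
  -- `O`, the union of cosets `K * O` lies between `K` and `U`.
  obtain ⟨K, hKB, hK, hKε⟩ := hB.exists_isCompact_sdiff_lt (measure_ne_top m B) hε2
  obtain ⟨U, hKU, hU, -, hUε⟩ :=
    hK.measurableSet.exists_isOpen_sdiff_lt (measure_ne_top m K) hε2
  obtain ⟨N, hN, hKN⟩ := compact_open_separated_mul_right hK hU hKU
  obtain ⟨N', hN'N, hN', h1⟩ := mem_nhds_iff.1 hN
  obtain ⟨O, hO⟩ := ProfiniteGrp.exist_openNormalSubgroup_sub_open_nhds_of_one hN' h1
  let B' : Set G := K * (O : Set G)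
  have hB'o : IsOpen B' := O.toOpenSubgroup.isOpen.mul_left
  have hKB' : K ⊆ B' := fun k hk => ⟨k, hk, 1, O.one_mem, mul_one k⟩
  have hB'U : B' ⊆ U := (mul_subset_mul_left (hO.trans hN'N)).trans hKN
  have hinv : ∀ h o, o ∈ O.toOpenSubgroup → h ∈ B' → h * o ∈ B' := by
    rintro h o ho ⟨k, hk, p, hp, rfl⟩
    exact ⟨k, hk, p * o, O.mul_mem hp ho, (mul_assoc k p o).symm⟩
  refine ⟨A ×ˢ B', ⟨hA.prod hB'o.measurableSet, O.toOpenSubgroup, fun t h o ho => ?_⟩, ?_⟩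
  · refine and_congr_right fun _ => ⟨fun hh => ?_, hinv h o ho⟩
    have := hinv (h * o) o⁻¹ (O.toOpenSubgroup.inv_mem ho) hh
    rwa [mul_inv_cancel_right] at this
  · calc (τ.prod m) (symmDiff (A ×ˢ B) (A ×ˢ B'))
        ≤ (τ.prod m) (univ ×ˢ ((B \ K) ∪ (U \ K))) := by
          refine measure_mono ?_
          rintro ⟨t, h⟩ (⟨⟨ht, hh⟩, hn⟩ | ⟨⟨ht, hh⟩, hn⟩)
          · exact ⟨trivial, .inl ⟨hh, fun hk => hn ⟨ht, hKB' hk⟩⟩⟩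
          · exact ⟨trivial, .inr ⟨hB'U hh, fun hk => hn ⟨ht, hKB hk⟩⟩⟩
      _ ≤ ε / 2 + ε / 2 := by
          rw [Measure.prod_prod, measure_univ, one_mul]
          exact (measure_union_le _ _).trans (add_le_add hKε.le hUε.le)
      _ = ε := ENNReal.add_halves ε

/-- Rectangles generate the σ-algebra, and approximability passes to complements and countable
disjoint unions. For a union the tail is discarded: only finitely many open subgroups can be
intersected. -/
theorem exists_isOpenInvariant_symmDiff_le (τ : Measure T) [IsProbabilityMeasure τ]
    (m : Measure G) [IsProbabilityMeasure m] [m.Regular] {S : Set (T × G)} (hS : MeasurableSet S)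
    {ε : ℝ≥0∞} (hε : ε ≠ 0) :
    ∃ S' : Set (T × G), IsOpenInvariant S' ∧ (τ.prod m) (symmDiff S S') ≤ ε := by
  induction S, hS using MeasurableSpace.induction_on_inter generateFrom_prod.symm isPiSystem_prod
    generalizing ε with
  | empty => exact ⟨∅, .empty, by simp⟩
  | basic S hS =>
    obtain ⟨A, hA, B, hB, rfl⟩ := hS
    exact exists_isOpenInvariant_symmDiff_prod_le τ m hA hB hε
  | compl S _ ih =>
    obtain ⟨S', hS', h⟩ := ih hε
    exact ⟨S'ᶜ, hS'.compl, by rwa [compl_symmDiff_compl]⟩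
  | iUnion f hdisj hf ih =>
    have hε2 : ε / 2 ≠ 0 := by simpa using hε
    obtain ⟨δ, hδ0, hδ⟩ := ENNReal.exists_pos_sum_of_countable' hε2 ℕ
    choose S' hS' h using fun n => ih n (hδ0 n).ne'
    have hsum : ∑' n, (τ.prod m) (f n) ≠ ∞ := by
      rw [← measure_iUnion hdisj hf]
      exact measure_ne_top _ _
    obtain ⟨N, hN⟩ := ((ENNReal.tendsto_sum_nat_add _ hsum).eventually
      (gt_mem_nhds (pos_iff_ne_zero.2 hε2))).exists
    refine ⟨⋃ n ∈ Finset.range N, S' n, .biUnion _ hS', ?_⟩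
    calc (τ.prod m) (symmDiff (⋃ n, f n) (⋃ n ∈ Finset.range N, S' n))
        ≤ (τ.prod m) ((⋃ n, f (n + N)) ∪ ⋃ n, symmDiff (f n) (S' n)) := by
          refine measure_mono ?_
          rintro y (⟨hy, hn⟩ | ⟨hy, hn⟩)
          · obtain ⟨n, hn'⟩ := mem_iUnion.1 hy
            by_cases hnN : n < N
            · refine .inr (mem_iUnion.2 ⟨n, .inl ⟨hn', fun h => hn ?_⟩⟩)
              exact mem_iUnion₂.2 ⟨n, Finset.mem_range.2 hnN, h⟩
            · refine .inl (mem_iUnion.2 ⟨n - N, ?_⟩)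
              rwa [Nat.sub_add_cancel (not_lt.1 hnN)]
          · obtain ⟨n, _, hn'⟩ := mem_iUnion₂.1 hy
            exact .inr (mem_iUnion.2 ⟨n, .inr ⟨hn', fun h => hn (mem_iUnion.2 ⟨n, h⟩)⟩⟩)
      _ ≤ ∑' n, (τ.prod m) (f (n + N)) + ∑' n, δ n :=
          (measure_union_le _ _).trans (add_le_add (measure_iUnion_le _)
            ((measure_iUnion_le _).trans (ENNReal.tsum_le_tsum h)))
      _ ≤ ε / 2 + ε / 2 := add_le_add hN.le hδ.le
      _ = ε := ENNReal.add_halves ε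

open Classical in
/-- A finite measurable colouring of `T × G` is nearly one that is invariant under right
translation of the second coordinate by an open subgroup. -/
theorem exists_invariant_colouring (τ : Measure T) [IsProbabilityMeasure τ]
    (m : Measure G) [IsProbabilityMeasure m] [m.Regular] {K : Type*} [Finite K] [Nonempty K]
    (c : T × G → K) (hc : ∀ i, MeasurableSet (c ⁻¹' {i})) {ε : ℝ} (hε : 0 < ε) :
    ∃ (c' : T × G → K) (O : OpenSubgroup G), (∀ i, MeasurableSet (c' ⁻¹' {i})) ∧
      (∀ t h, ∀ o ∈ O, c' (t, h * o) = c' (t, h)) ∧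
      (τ.prod m).real {y | c' y ≠ c y} ≤ ε := by
  have : Fintype K := Fintype.ofFinite K
  have hδ : ENNReal.ofReal (ε / Fintype.card K) ≠ 0 := by
    have : (0 : ℝ) < Fintype.card K := by exact_mod_cast Fintype.card_pos
    simpa using div_pos hε this
  choose S hS h using fun i => exists_isOpenInvariant_symmDiff_le τ m (hc i) hδ
  choose hm O hO using hS
  -- `g` decodes the set of colours whose approximating sets contain a point; off the symmetric
  -- differences this set is the singleton of the true colour.
  let g : Set K → K := fun s => if h : s.Nonempty then h.some else Classical.arbitrary K
  have hg : ∀ i, g {i} = i := fun i => by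
    have h : ({i} : Set K).Nonempty := singleton_nonempty i
    simpa [g] using h.some_mem
  refine ⟨fun y => g {i | y ∈ S i}, Finset.univ.inf O, fun i => ?_, fun t x o ho => ?_, ?_⟩
  · have : (fun y => g {i | y ∈ S i}) ⁻¹' {i} =
        ⋃ s ∈ {s : Set K | g s = i}, ⋂ j, if j ∈ s then S j else (S j)ᶜ := by
      ext y
      simp only [mem_preimage, mem_singleton_iff, mem_iUnion, mem_iInter, mem_ofPred_eq,
        exists_prop]
      constructor
      · intro hy
        refine ⟨_, hy, fun j => ?_⟩
        by_cases hj : y ∈ S j <;> simp [hj]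
      · rintro ⟨s, rfl, hs⟩
        congr 1
        ext j
        have := hs j
        by_cases hj : j ∈ s <;> simp_all
    rw [this]
    refine (toFinite _).measurableSet_biUnion fun s _ => MeasurableSet.iInter fun j => ?_
    split_ifs
    exacts [hm j, (hm j).compl]
  · have : {i | (t, x * o) ∈ S i} = {i | (t, x) ∈ S i} := by
      ext i
      exact hO i t x o (Finset.inf_le (f := O) (Finset.mem_univ i) ho)
    change g {i | (t, x * o) ∈ S i} = _
    rw [this]
  · calc _ ≤ (τ.prod m).real (⋃ i, symmDiff (c ⁻¹' {i}) (S i)) := by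
          refine measureReal_mono fun y hy => ?_
          by_contra hn
          simp only [mem_iUnion, not_exists, mem_symmDiff, not_or, not_and, not_not,
            mem_preimage, mem_singleton_iff] at hn
          refine hy ?_
          have : {i | y ∈ S i} = {c y} := by
            ext i
            exact ⟨fun hi => ((hn i).2 hi).symm, fun hi => (hn i).1 hi.symm⟩
          change g {i | y ∈ S i} = c y
          rw [this, hg]
      _ ≤ ∑ i, (τ.prod m).real (symmDiff (c ⁻¹' {i}) (S i)) := measureReal_iUnion_fintype_le _
      _ ≤ ∑ i : K, ε / Fintype.card K := by
          refine Finset.sum_le_sum fun i _ => ?_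
          exact ENNReal.toReal_le_of_le_ofReal (by positivity) (h i)
      _ = ε := by
          have : (Fintype.card K : ℝ) ≠ 0 := by exact_mod_cast Fintype.card_ne_zero
          simp; field_simp

end cylinders

/-! ### Finite factors of the profinite completion -/

namespace ProfiniteHat

variable (Γ : Type*) [Group Γ]

instance : TotallyDisconnectedSpace (ProfiniteHat Γ) :=
  inferInstanceAs
    (TotallyDisconnectedSpace (ProfiniteGrp.ProfiniteCompletion.completion (GrpCat.of Γ)))

instance : T2Space (ProfiniteHat Γ) :=
  inferInstanceAs (T2Space (ProfiniteGrp.ProfiniteCompletion.completion (GrpCat.of Γ)))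

instance : (haar Γ).Regular :=
  inferInstanceAs (Measure.haarMeasure _).Regular

variable {Γ}

/-- The projection of the profinite completion to a finite quotient. -/
def proj (N : FiniteIndexNormalSubgroup Γ) (h : ProfiniteHat Γ) : Γ ⧸ N.toSubgroup :=
  h.1 N

theorem proj_ofGroup_mul (N : FiniteIndexNormalSubgroup Γ) (γ : Γ) (h : ProfiniteHat Γ) :
    proj N (ofGroup Γ γ * h) = (γ : Γ ⧸ N.toSubgroup) * proj N h :=
  rfl

theorem isOpen_preimage_proj (N : FiniteIndexNormalSubgroup Γ) (S : Set (Γ ⧸ N.toSubgroup)) :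
    IsOpen (proj N ⁻¹' S) := by
  have h : Continuous fun x : ProfiniteGrp.limitConePtAux
      (ProfiniteGrp.ProfiniteCompletion.diagram (GrpCat.of Γ)) => x.1 N :=
    (continuous_apply N).comp continuous_subtype_val
  exact h.isOpen_preimage S trivial

/-- The profinite completion maps equivariantly and measurably to any transitive finite action, and
the Haar measure is mapped to the uniform measure. -/
theorem exists_factor {V : Type*} [Finite V] [Nonempty V] (σ : Γ →* Equiv.Perm V)
    (hσ : ∀ v w, ∃ γ, σ γ v = w) :
    ∃ Φ : ProfiniteHat Γ → V, (∀ S, MeasurableSet (Φ ⁻¹' S)) ∧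
      (∀ γ h, Φ ((action Γ).toHom γ h) = σ γ (Φ h)) ∧
      ∀ Q : V → Prop, (haar Γ).real {h | Q (Φ h)} = freq Q := by
  classical
  have : Fintype V := Fintype.ofFinite V
  obtain ⟨v₀⟩ := ‹Nonempty V›
  -- The orbit map of `v₀` factors through the finite quotient by `σ.ker`, and so extends to the
  -- completion.
  let N : FiniteIndexNormalSubgroup Γ := FiniteIndexNormalSubgroup.ofSubgroup σ.ker
  let Φ : ProfiniteHat Γ → V := fun h => QuotientGroup.kerLift σ (proj N h) v₀
  have hmeas : ∀ S, MeasurableSet (Φ ⁻¹' S) := fun S =>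
    (isOpen_preimage_proj N ((fun q => QuotientGroup.kerLift σ q v₀) ⁻¹' S)).measurableSet
  have hequiv : ∀ γ h, Φ ((action Γ).toHom γ h) = σ γ (Φ h) := fun γ h => by
    change QuotientGroup.kerLift σ (proj N (ofGroup Γ γ * h)) v₀ = _
    rw [proj_ofGroup_mul]
    exact (congrArg (· v₀) (map_mul (QuotientGroup.kerLift σ) _ _)).trans rfl
  -- Transitivity and invariance of Haar measure make all fibres equally large.
  have hconst : ∀ v w, (haar Γ).real {h | Φ h = v} = (haar Γ).real {h | Φ h = w} := by
    intro v w
    obtain ⟨γ, rfl⟩ := hσ v w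
    have hpre := ((action Γ).measurePreserving γ).measureReal_preimage
      (hmeas {σ γ v}).nullMeasurableSet
    refine Eq.trans ?_ hpre
    congr 1
    ext h
    change Φ h = v ↔ Φ ((action Γ).toHom γ h) = σ γ v
    rw [hequiv, (σ γ).apply_eq_iff_eq]
  have hsum : ∑ v, (haar Γ).real {h | Φ h = v} = 1 := by
    have := measureReal_comp_eq_sum (haar Γ) Φ (fun v => hmeas {v}) fun _ => True
    simpa using this.symm
  have hval : ∀ v, (haar Γ).real {h | Φ h = v} = freq fun w => w = v := by
    intro v
    have h1 : (Fintype.card V : ℝ) * (haar Γ).real {h | Φ h = v} = 1 := by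
      rw [← hsum, Finset.sum_congr rfl fun w _ => hconst w v]
      simp
    have h2 : freq (fun w : V => w = v) = 1 / Fintype.card V := by
      simp [freq]
    rw [h2, eq_div_iff (by exact_mod_cast Fintype.card_ne_zero), mul_comm]
    exact h1
  refine ⟨Φ, hmeas, hequiv, fun Q => ?_⟩
  rw [measureReal_comp_eq_sum (haar Γ) Φ fun v => hmeas {v}]
  have := freq_comp_eq_sum (fun v : V => v) Q
  rw [this]
  exact Finset.sum_congr rfl fun v _ => hval v

end ProfiniteHat

/-! ### From MD to finite models, and from transitive models to EMD -/

/-- Colourings that rarely differ have nearly the same statistics. -/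
theorem MPAction.abs_measureReal_sub_le {Γ Y K : Type*} [Group Γ] [MeasurableSpace Y]
    {ν : Measure Y} [IsFiniteMeasure ν] (b : MPAction Γ ν) [Countable K] {c c' : Y → K}
    (hc : ∀ i, MeasurableSet (c ⁻¹' {i})) (hc' : ∀ i, MeasurableSet (c' ⁻¹' {i})) (γ : Γ)
    (i j : K) :
    |ν.real {y | c y = i ∧ c (b.toHom γ y) = j} - ν.real {y | c' y = i ∧ c' (b.toHom γ y) = j}| ≤
      2 * ν.real {y | c' y ≠ c y} := by
  let _ : MeasurableSpace K := ⊤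
  have hm : Measurable c := measurable_to_countable' hc
  have hm' : Measurable c' := measurable_to_countable' hc'
  have hγ := (b.measurePreserving γ).measurable
  have hne : MeasurableSet {y | c' y ≠ c y} := (measurableSet_eq_fun hm' hm).compl
  have hset : ∀ {f : Y → K}, Measurable f →
      MeasurableSet {y | f y = i ∧ f (b.toHom γ y) = j} := fun hf =>
    (hf (measurableSet_singleton i)).inter ((hf.comp hγ) (measurableSet_singleton j))
  refine (abs_measureReal_sub_le_measureReal_symmDiff (hset hm).nullMeasurableSet
    (hset hm').nullMeasurableSet).trans ?_
  have hpre := (b.measurePreserving γ).measureReal_preimage hne.nullMeasurableSet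
  calc _ ≤ ν.real ({y | c' y ≠ c y} ∪ b.toHom γ ⁻¹' {y | c' y ≠ c y}) := by
        refine measureReal_mono fun y hy => ?_
        by_contra! hn
        simp only [mem_union, mem_ofPred_eq, mem_preimage, not_or, not_not] at hn
        simp only [mem_symmDiff, mem_ofPred_eq, hn.1, hn.2] at hy
        tauto
    _ ≤ _ := (measureReal_union_le _ _).trans (by rw [hpre, two_mul])

/-- Groups with property MD are finitely approximable. -/
theorem HasMD.finitelyApproximable {Γ : Type*} [Group Γ] (h : HasMD Γ) :
    FinitelyApproximable Γ := by
  intro X _ _ μ _ a K _ c hc F ε hε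
  obtain ⟨x₀⟩ : Nonempty X := by
    by_contra h
    rw [not_nonempty_iff] at h
    exact IsProbabilityMeasure.ne_zero μ (Measure.eq_zero_of_isEmpty μ)
  have : Nonempty K := ⟨c x₀⟩
  obtain ⟨n, ⟨θ⟩⟩ := Finite.exists_equiv_fin K
  let b := (MPAction.trivialAction Γ (volume : Measure unitInterval)).prod (ProfiniteHat.action Γ)
  obtain ⟨c₁, hc₁, h₁⟩ := (a.weaklyContained_iff b).1 (h.2.2 X μ a) n (fun x => θ (c x))
    (fun i => by
      have : (fun x => θ (c x)) ⁻¹' {i} = c ⁻¹' {θ.symm i} := by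
        ext x; simp [Equiv.eq_symm_apply]
      exact this ▸ hc _) F (ε / 2) (half_pos hε)
  have : Nonempty (Fin n) := ⟨θ (c x₀)⟩
  -- The errors add up to `ε / 2 + 2 * (ε / 8) + ε / 8 < ε`.
  obtain ⟨c₂, O, hc₂, hO, h₂⟩ := exists_invariant_colouring (volume : Measure unitInterval)
    (ProfiniteHat.haar Γ) c₁ hc₁ (ε := ε / 8) (by positivity)
  let Q := ProfiniteHat Γ ⧸ O.toSubgroup
  have : Finite Q := O.toSubgroup.quotient_finite_of_isOpen O.isOpen
  -- The point `t` is remembered only through the colours it gives to all cosets. `Γ` fixes this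
  -- datum and translates the coset; evaluation recovers `c₂` by `O`-invariance.
  let e : unitInterval × ProfiniteHat Γ → (Q → Fin n) × Q :=
    fun y => (fun q => c₂ (y.1, q.out), (y.2 : Q))
  have he : ∀ w, MeasurableSet (e ⁻¹' {w}) := by
    rintro ⟨l, q⟩
    have : e ⁻¹' {(l, q)} = (⋂ p : Q, (fun t => (t, p.out)) ⁻¹' (c₂ ⁻¹' {l p})) ×ˢ
        ((↑) ⁻¹' ({q} : Set Q)) := by
      ext y; simp [e, funext_iff]
    rw [this]
    refine MeasurableSet.prod (MeasurableSet.iInter fun p => measurable_prodMk_right (hc₂ _)) ?_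
    have : DiscreteTopology Q := QuotientGroup.discreteTopology O.isOpen
    exact ((isOpen_discrete ({q} : Set Q)).preimage continuous_quotient_mk').measurableSet
  obtain ⟨V, hV, hV', σ, d, hd⟩ := b.exists_approximates_of_factor
    (prodPerm 1 ((MulAction.toPermHom (ProfiniteHat Γ) Q).comp (ProfiniteHat.ofGroup Γ)))
    e he (fun γ y => rfl) (fun w => w.1 w.2) (ε := ε / 8) (by positivity)
  have hce : ∀ y, (e y).1 (e y).2 = c₂ y := by
    rintro ⟨t, x⟩
    obtain ⟨o, ho⟩ := QuotientGroup.mk_out_eq_mul O.toSubgroup x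
    change c₂ (t, (x : Q).out) = _
    rw [ho]
    exact hO t x o o.2
  simp only [hce] at hd
  refine ⟨V, hV, hV', σ, fun v => θ.symm (d v), fun γ hγ i j => ?_⟩
  have e₁ := h₁ γ hγ (θ i) (θ j)
  have e₂ := b.abs_measureReal_sub_le hc₁ hc₂ γ (θ i) (θ j)
  have e₃ := hd F γ hγ (θ i) (θ j)
  simp only [EmbeddingLike.apply_eq_iff_eq] at e₁
  simp only [Equiv.symm_apply_eq]
  rw [abs_lt] at e₁ e₃ ⊢
  rw [abs_le] at e₂
  constructor <;> linarith

/-- Transitively approximable countable groups have property EMD. -/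
theorem TransitivelyApproximable.hasEMD {Γ : Type*} [Group Γ] [Countable Γ]
    (h : TransitivelyApproximable Γ) : HasEMD Γ := by
  refine ⟨inferInstance, ?_, ?_⟩
  -- A finite group has no transitive action on more points than it has elements.
  · by_contra hfin
    rw [not_infinite_iff_finite] at hfin
    obtain ⟨V, _, ⟨v⟩, σ, -, hcard, htrans, -⟩ := h Unit (Measure.dirac ())
      (MPAction.trivialAction Γ _) Unit id (fun _ => .of_discrete) ∅ 1 one_pos (Nat.card Γ + 1)
    have := Nat.card_le_card_of_surjective (fun γ => σ γ v) (htrans v)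
    omega
  · intro X _ _ μ _ a
    rw [MPAction.weaklyContained_iff]
    intro k c hc F ε hε
    obtain ⟨V, _, _, σ, d, -, htrans, hd⟩ := h X μ a (Fin k) c hc F ε hε 0
    obtain ⟨Φ, hΦ, heq, hfreq⟩ := ProfiniteHat.exists_factor σ htrans
    refine ⟨fun y => d (Φ y), fun i => hΦ (d ⁻¹' {i}), fun γ hγ i j => ?_⟩
    have := hd γ hγ i j
    rw [← hfreq] at this
    simpa only [heq] using this

theorem theorem4p7 {Γ₁ Γ₂ : Type*} [Group Γ₁] [Group Γ₂] [Countable Γ₁] [Countable Γ₂]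
    [Nontrivial Γ₁] [Nontrivial Γ₂]
    (h₁ : Finite Γ₁ ∨ HasMD Γ₁) (h₂ : Finite Γ₂ ∨ HasMD Γ₂) :
    HasEMD (Monoid.Coprod Γ₁ Γ₂) := by
  have f₁ : FinitelyApproximable Γ₁ :=
    h₁.elim (fun _ => .of_finite Γ₁) fun h => h.finitelyApproximable
  have f₂ : FinitelyApproximable Γ₂ :=
    h₂.elim (fun _ => .of_finite Γ₂) fun h => h.finitelyApproximable
  obtain ⟨W₁, _, _, ρ₁, hρ₁⟩ := f₁.exists_fixedPointFree
  obtain ⟨W₂, _, _, ρ₂, hρ₂⟩ := f₂.exists_fixedPointFree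
  have : Countable (Monoid.Coprod Γ₁ Γ₂) := Monoid.Coprod.mk_surjective.countable
  exact (f₁.coprod f₂ ρ₁ ρ₂ hρ₁ hρ₂).hasEMD
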